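/- Let $r\in\{\infty,\omega\}$, let $M$ be a paracompact Hausdorff finite-dimensional real $C^r$-manifold, and let $f,g_1,\dots,g_m$ be $C^r$-vector fields on $M$, defining the affine control system $\Sigma:\ \dot x=f(x)+\sum_{i=1}^m g_i(x)u_i$. Put $G_q=\operatorname{span}_{\mathbb R}\{g_1(q),\dots,g_m(q)\}\subseteq T_qM$ for $q\in M$. Let $D$ be an involutive regular $C^r$-distribution on $M$: a family of subspaces $D_q\subseteq T_qM$ of locally constant dimension, locally spanned pointwise by $C^r$-vector fields, and such that the Lie bracket of two local $C^r$-sections of $D$ is again a section of $D$. For a family $L$ of subspaces of $TM$ and $U\subseteq M$ open, $\Gamma^r(U;L)$ denotes the set of $C^r$-vector fields $X$ on $U$ with $X(q)\in L_q$ for all $q\in U$. The distribution $D$ is called locally controlled invariant for $\Sigma$ at $p\in M$ if there is a sufficiently small open neighbourhood $U$ of $p$ (that is, every neighbourhood of $p$ contains such a $U$) together with $C^r$-functions $\alpha=(\alpha_i):U\to\mathbb R^m$ and $\beta=(\beta_{ij}):U\to GL(m,\mathbb R)$ such that, with $\hat f=f+\sum_i\alpha_i g_i$ and $\hat g_i=\sum_j\beta_{ij}g_j$,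 $$[\hat f,\Gamma^r(U;D)]\subseteq\Gamma^r(U;D),\qquad [\hat g_i,\Gamma^r(U;D)]\subseteq\Gamma^r(U;D),\quad i=1,\dots,m.$$ Let $p\in M$ be a regular point of $(G+D)/D$, i.e. the dimension of $(G_q+D_q)/D_q\subseteq T_qM/D_q$ is constant for $q$ in a neighbourhood of $p$. Then $D$ is locally controlled invariant for $\Sigma$ at $p$ if and only if there is a sufficiently small open neighbourhood $U$ of $p$ (that is, every neighbourhood of $p$ contains such a $U$) with $$[g_i,\Gamma^r(U;D)]\subseteq\Gamma^r(U;D)+\Gamma^r(U;G),\quad i=1,\dots,m,\qquad [f,\Gamma^r(U;D)]\subseteq\Gamma^r(U;D)+\Gamma^r(U;G).$$ -/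

import Mathlib

open scoped Manifold ContDiff Topology Pointwise

namespace ControlledInvariance

noncomputable section

variable {E : Type*} [NormedAddCommGroup E] [NormedSpace ℝ E]
  {M : Type*} [TopologicalSpace M] [ChartedSpace E M]

/-- A (not necessarily continuous) vector field on the manifold `M` modelled on `E`. A vector field
on an open set `U` is represented by any extension to `M`; only its values on `U` matter. -/
abbrev VField (E : Type*) [NormedAddCommGroup E] [NormedSpace ℝ E]
    (M : Type*) [TopologicalSpace M] [ChartedSpace E M] : Type _ :=
  Π x : M, TangentSpace 𝓘(ℝ, E) x

/-- A generalized distribution: a linear subspace of each tangent space, without any continuity or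
constancy of the dimension. -/
abbrev GenDistribution (E : Type*) [NormedAddCommGroup E] [NormedSpace ℝ E]
    (M : Type*) [TopologicalSpace M] [ChartedSpace E M] : Type _ :=
  Π x : M, Submodule ℝ (TangentSpace 𝓘(ℝ, E) x)

/-- `p` is a regular point of the family `L` of subspaces `L x ⊆ V x`: the dimension of `L x` is
constant on a neighbourhood of `p`. -/
def IsRegularPoint {X : Type*} [TopologicalSpace X] {V : X → Type*} [∀ x, AddCommGroup (V x)]
    [∀ x, Module ℝ (V x)] (L : Π x, Submodule ℝ (V x)) (p : X) : Prop :=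
  ∃ U : Set X, IsOpen U ∧ p ∈ U ∧ ∀ q ∈ U, Module.finrank ℝ (L q) = Module.finrank ℝ (L p)

/-- The generalized distribution spanned pointwise by a finite family of vector fields. -/
def spanDistribution {m : ℕ} (g : Fin m → VField E M) : GenDistribution E M :=
  fun x => Submodule.span ℝ (Set.range fun i => g i x)

/-- The generalized subbundle `(G + D) / D` of `TM / D`. -/
def quotientSubbundle (G D : GenDistribution E M) (x : M) :
    Submodule ℝ (TangentSpace 𝓘(ℝ, E) x ⧸ D x) :=
  Submodule.map (D x).mkQ (G x ⊔ D x)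

/-- `f` is a real-valued function of class `C^r` on `U`. -/
def IsFunctionOn (r : WithTop ℕ∞) (U : Set M) (f : M → ℝ) : Prop :=
  ContMDiffOn 𝓘(ℝ, E) 𝓘(ℝ, ℝ) r f U

/-- `[X, S]`: the set of Lie brackets of `X` with the members of `S`. -/
def bracketSet (X : VField E M) (S : Set (VField E M)) : Set (VField E M) :=
  (fun Y => VectorField.mlieBracket 𝓘(ℝ, E) X Y) '' S

/-- The drift `f + ∑ i, α i • g i` of the system obtained by feedback. -/
def feedbackDrift {m : ℕ} (f : VField E M) (g : Fin m → VField E M) (α : Fin m → M → ℝ) :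
    VField E M :=
  fun x => f x + ∑ i, α i x • g i x

/-- The input vector fields `∑ j, β i j • g j` of the system obtained by feedback. -/
def feedbackInput {m : ℕ} (g : Fin m → VField E M) (β : M → GL (Fin m) ℝ) (i : Fin m) :
    VField E M :=
  fun x => ∑ j, (β x : Matrix (Fin m) (Fin m) ℝ) i j • g j x

/-- `(α, β)` is a pair of `C^r` feedback functions `α : U → ℝ^m`, `β : U → GL(m, ℝ)`. -/
def IsFeedbackOn (E : Type*) [NormedAddCommGroup E] [NormedSpace ℝ E]
    {M : Type*} [TopologicalSpace M] [ChartedSpace E M]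
    (r : WithTop ℕ∞) (U : Set M) {m : ℕ} (α : Fin m → M → ℝ) (β : M → GL (Fin m) ℝ) : Prop :=
  (∀ i, IsFunctionOn (E := E) r U (α i)) ∧
  ∀ i j, IsFunctionOn (E := E) r U (fun x => (β x : Matrix (Fin m) (Fin m) ℝ) i j)

variable [IsManifold 𝓘(ℝ, E) 1 M]

/-- `X` is a vector field of class `C^r` on `U`. -/
def IsVFieldOn (r : WithTop ℕ∞) (U : Set M) (X : VField E M) : Prop :=
  ContMDiffOn 𝓘(ℝ, E) 𝓘(ℝ, E).tangent r
    (fun x => (⟨x, X x⟩ : TangentBundle 𝓘(ℝ, E) M)) U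

/-- `Γ^r(U; D)`: the sections of `D` over `U` of class `C^r`. -/
def sectionsOn (r : WithTop ℕ∞) (U : Set M) (D : GenDistribution E M) : Set (VField E M) :=
  {X | IsVFieldOn r U X ∧ ∀ x ∈ U, X x ∈ D x}

/-- A generalized distribution is of class `C^r` if near every point it is spanned pointwise by a
family of vector fields of class `C^r`. -/
def IsOfClass (r : WithTop ℕ∞) (D : GenDistribution E M) : Prop :=
  ∀ p : M, ∃ U : Set M, IsOpen U ∧ p ∈ U ∧ ∃ S : Set (VField E M),
    (∀ X ∈ S, IsVFieldOn r U X) ∧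
    ∀ q ∈ U, D q = Submodule.span ℝ ((fun X : VField E M => X q) '' S)

/-- The Lie bracket of two local `C^r` sections of `D` is again a local `C^r` section of `D`. -/
def IsInvolutive (r : WithTop ℕ∞) (D : GenDistribution E M) : Prop :=
  ∀ U : Set M, IsOpen U → ∀ X ∈ sectionsOn r U D,
    bracketSet X (sectionsOn r U D) ⊆ sectionsOn r U D

/-- An involutive regular `C^r`-distribution. -/
structure IsInvolutiveRegularDistribution (r : WithTop ℕ∞) (D : GenDistribution E M) : Prop where
  isOfClass : IsOfClass r D
  regular : ∀ p, IsRegularPoint D p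
  involutive : IsInvolutive r D

/-- `D` is locally controlled invariant at `p` for the system `ẋ = f(x) + ∑ i, u i • g i(x)`: there
are arbitrarily small open neighbourhoods `U` of `p` carrying `C^r` feedback functions after which
the bracket of the drift and of each input field maps `Γ^r(U; D)` into itself. -/
def LocallyControlledInvariantAt (r : WithTop ℕ∞) {m : ℕ} (f : VField E M)
    (g : Fin m → VField E M) (D : GenDistribution E M) (p : M) : Prop :=
  ∀ W ∈ 𝓝 p, ∃ U : Set M, IsOpen U ∧ p ∈ U ∧ U ⊆ W ∧
    ∃ (α : Fin m → M → ℝ) (β : M → GL (Fin m) ℝ), IsFeedbackOn E r U α β ∧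
      bracketSet (feedbackDrift f g α) (sectionsOn r U D) ⊆ sectionsOn r U D ∧
      ∀ i, bracketSet (feedbackInput g β i) (sectionsOn r U D) ⊆ sectionsOn r U D

end

end ControlledInvariance

open ControlledInvariance

/-!
The problem is local and is solved in the preferred chart at `p`, where vector fields are maps
`E → E`, brackets are `VectorField.lieBracket ℝ`, and near `p` the distribution `D` is the range of
an injective field of linear maps `X x : F → E` (`exists_frame`).

**Necessity.** By the Leibniz rule, `[f + ∑ α i • g i, Y]` differs from `[f, Y] + ∑ α i • [g i, Y]`
by a combination of the `g i` with coefficients of class `C^r`, and likewise for the new inputs.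
Inverting the matrix `β` gives `[g i, Y]`, and then `[f, Y]`, as a section of `D` plus a section of
`G` (`exists_bracket_input`, `exists_bracket_drift`).

**Sufficiency.** Since `(G + D) / D` has constant rank, some of the `g i` form with `X` a frame of
`G + D` near `p`. The frame `X` can be normalized to a commuting one, `T` (`exists_adaptedFrame`).
Writing `γ` for the coefficients along the chosen `g i`, the condition that
`[T a, f + ∑ P i • g i]` be a section of `D` is the system of differential equations
`DP(x) (T x a) = B (x, P x) a`, with `B` built from `γ [T a, f]` and `γ [T a, g i]` (`feedbackRHS`).
Its integrability condition is the Jacobi identity for `T a`, `T b` and `f + ∑ P i • g i`, where `P`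
is an affine function solving the equation at the point in question (`fderiv_feedbackRHS_symm`).
Integrability says that the columns of the field `(T, B)` on `E × ℝ^ι` commute, so that
`P` is obtained by flowing out of a transversal to `D` along these columns
(`exists_solution_along_frame`). This yields `α`, with `α = 0` at `p`. With each
`g i` as the drift, the same construction yields fields `g i + ∑ δ i j • g j`, that is, a matrix
`β = 1 + δ` equal to `1` at `p` and hence invertible near `p` (`exists_regular_feedback`).

The joint flow of commuting fields is needed in the classes `C^∞` and `C^ω`
(`exists_commuting_flow`). The integral equation `z = y + ∫ T (z) v` on `C([0, 1], E)` is solved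
by the inverse function theorem; its regularity is that of the superposition operators
`z ↦ h ∘ z`, which near constant curves are as regular as `h`, whether smooth or analytic
(`exists_contDiffOn_superposition`). At `v = 0` the derivative is a shear. That the solution map
has derivative `T` in the direction of `v` is the uniqueness of solutions of the linearized
equation, solved explicitly in the commuting case (`primitive_variation`).
-/

namespace ControlledInvariance

/-! ### Superposition operators on spaces of continuous maps -/

section Superposition

variable {K : Type*} [TopologicalSpace K] [CompactSpace K]

open Classical in
/-- The superposition operator `γ ↦ h ∘ γ` between spaces of continuous maps. As `h` is usually
continuous on an open set only, the value is `0` where `h ∘ γ` fails to be continuous. -/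
noncomputable def superposition {K H H' : Type*} [TopologicalSpace K] [TopologicalSpace H]
    [TopologicalSpace H'] [Zero H'] (h : H → H') (γ : C(K, H)) : C(K, H') :=
  if hc : Continuous (h ∘ γ) then ⟨h ∘ γ, hc⟩ else 0

omit [CompactSpace K] in
theorem superposition_apply {H H' : Type*} [TopologicalSpace H]
    [TopologicalSpace H'] [Zero H'] {h : H → H'} {O : Set H} (hO : ContinuousOn h O) {γ : C(K, H)}
    (hγ : ∀ s, γ s ∈ O) (s : K) : superposition h γ s = h (γ s) := by
  have hc : Continuous (h ∘ γ) := hO.comp_continuous γ.continuous hγ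
  simp [superposition, hc]

theorem isOpen_setOf_forall_mem {H : Type*} [TopologicalSpace H] {O : Set H} (hO : IsOpen O) :
    IsOpen {γ : C(K, H) | ∀ s, γ s ∈ O} := by
  have := ContinuousMap.isOpen_setOfPred_mapsTo (X := K) (isCompact_univ) hO
  simpa [Set.MapsTo] using this

variable {H H' : Type*} [NormedAddCommGroup H] [NormedSpace ℝ H]
  [NormedAddCommGroup H'] [NormedSpace ℝ H']

/-- Pointwise application `φ ↦ (ζ ↦ (s ↦ φ s (ζ s)))`, as a continuous linear map into operators. -/
noncomputable def pointwiseApply (K H H' : Type*) [TopologicalSpace K] [CompactSpace K]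
    [NormedAddCommGroup H] [NormedSpace ℝ H] [NormedAddCommGroup H'] [NormedSpace ℝ H'] :
    C(K, H →L[ℝ] H') →L[ℝ] C(K, H) →L[ℝ] C(K, H') :=
  LinearMap.mkContinuous₂
    (LinearMap.mk₂ ℝ (fun (φ : C(K, H →L[ℝ] H')) (ζ : C(K, H)) =>
        (⟨fun s => φ s (ζ s), φ.continuous.clm_apply ζ.continuous⟩ : C(K, H')))
      (fun _ _ _ => by ext; simp) (fun _ _ _ => by ext; simp)
      (fun _ _ _ => by ext; simp) (fun _ _ _ => by ext; simp)) 1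
    (fun φ ζ => by
      rw [one_mul, ContinuousMap.norm_le _ (by positivity)]
      intro s
      calc ‖φ s (ζ s)‖ ≤ ‖φ s‖ * ‖ζ s‖ := (φ s).le_opNorm _
        _ ≤ ‖φ‖ * ‖ζ‖ := by gcongr <;> exact ContinuousMap.norm_coe_le_norm _ s)

@[simp] theorem pointwiseApply_apply (φ : C(K, H →L[ℝ] H')) (ζ : C(K, H)) (s : K) :
    pointwiseApply K H H' φ ζ s = φ s (ζ s) := rfl

omit [NormedSpace ℝ H] [NormedSpace ℝ H'] in
/-- Continuity of `h` on `O` is uniform at the points of the compact range of a curve. -/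
theorem continuousOn_superposition {h : H → H'} {O : Set H} (hO : IsOpen O)
    (hh : ContinuousOn h O) :
    ContinuousOn (superposition (K := K) h) {γ | ∀ s, γ s ∈ O} := by
  intro γ hγ
  rw [ContinuousWithinAt, Metric.tendsto_nhds]
  intro ε hε
  have hc : IsCompact (Set.range γ) := isCompact_range γ.continuous
  have key := hc.uniformContinuousAt_of_continuousAt h
    (fun a ha => by
      obtain ⟨s, rfl⟩ := ha
      exact hh.continuousAt (hO.mem_nhds (hγ s))) (Metric.dist_mem_uniformity (half_pos hε))
  obtain ⟨δ, hδ, hδ'⟩ := Metric.mem_uniformity_dist.1 key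
  filter_upwards [self_mem_nhdsWithin, mem_nhdsWithin_of_mem_nhds (Metric.ball_mem_nhds γ hδ)]
    with γ' h1 h2
  refine lt_of_le_of_lt ?_ (half_lt_self hε)
  rw [ContinuousMap.dist_le (half_pos hε).le]
  intro s
  rw [superposition_apply hh h1, superposition_apply hh hγ, dist_comm]
  have h3 : dist (γ s) (γ' s) < δ := by
    rw [dist_comm]
    exact (ContinuousMap.dist_apply_le_dist s).trans_lt h2
  exact (hδ' h3 ⟨s, rfl⟩).le

/-- The derivative of a superposition operator is the pointwise derivative: the mean value
inequality bounds the remainder by the oscillation of `fderiv ℝ h` near the compact range of `γ`. -/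
theorem hasFDerivAt_superposition {h : H → H'} {O : Set H} (hO : IsOpen O)
    (hh : ContDiffOn ℝ 1 h O) {γ : C(K, H)} (hγ : ∀ s, γ s ∈ O) :
    HasFDerivAt (superposition (K := K) h)
      (pointwiseApply K H H' (superposition (fderiv ℝ h) γ)) γ := by
  have hd : ContinuousOn (fderiv ℝ h) O := hh.continuousOn_fderiv_of_isOpen hO le_rfl
  have hdiff : ∀ x ∈ O, HasFDerivAt h (fderiv ℝ h x) x := fun x hx =>
    ((hh.differentiableOn one_ne_zero x hx).differentiableAt (hO.mem_nhds hx)).hasFDerivAt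
  rw [hasFDerivAt_iff_isLittleO_nhds_zero, Asymptotics.isLittleO_iff]
  intro ε hε
  have hc : IsCompact (Set.range γ) := isCompact_range γ.continuous
  have key := hc.uniformContinuousAt_of_continuousAt (fderiv ℝ h)
    (fun a ha => by
      obtain ⟨s, rfl⟩ := ha
      exact hd.continuousAt (hO.mem_nhds (hγ s))) (Metric.dist_mem_uniformity hε)
  obtain ⟨δ, hδ, hδ'⟩ := Metric.mem_uniformity_dist.1 key
  obtain ⟨δ₂, hδ₂, hsub⟩ := hc.exists_thickening_subset_open hO (by
    rintro _ ⟨s, rfl⟩; exact hγ s)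
  filter_upwards [Metric.ball_mem_nhds (0 : C(K, H)) (lt_min hδ hδ₂)] with ζ hζ
  have hζ' : ‖ζ‖ < min δ δ₂ := by simpa using hζ
  have hball : ∀ s, Metric.ball (γ s) (min δ δ₂) ⊆ O := fun s x hx =>
    hsub (Metric.mem_thickening_iff.2 ⟨γ s, ⟨s, rfl⟩, hx.trans_le (min_le_right _ _)⟩)
  have hmem : ∀ s, γ s + ζ s ∈ Metric.ball (γ s) (min δ δ₂) := fun s => by
    simpa using (ζ.norm_coe_le_norm s).trans_lt hζ'
  rw [ContinuousMap.norm_le _ (by positivity)]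
  intro s
  have e1 : superposition h (γ + ζ) s = h (γ s + ζ s) :=
    superposition_apply hh.continuousOn (fun s => hball s (hmem s)) s
  simp only [ContinuousMap.coe_sub, Pi.sub_apply, e1, superposition_apply hh.continuousOn hγ,
    pointwiseApply_apply, superposition_apply hd hγ]
  have := (convex_ball (γ s) (min δ δ₂)).norm_image_sub_le_of_norm_hasFDerivWithin_le'
    (f := h) (f' := fderiv ℝ h) (φ := fderiv ℝ h (γ s)) (C := ε)
    (fun x hx => (hdiff x (hball s hx)).hasFDerivWithinAt)
    (fun x hx => by
      rw [← dist_eq_norm, dist_comm]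
      refine (hδ' ?_ ⟨s, rfl⟩).le
      rw [dist_comm]
      exact lt_of_lt_of_le hx (min_le_left _ _))
    (Metric.mem_ball_self (lt_min hδ hδ₂)) (hmem s)
  simp only [add_sub_cancel_left] at this
  exact this.trans (by gcongr; exact ζ.norm_coe_le_norm s)

/-- Finite differentiability, by induction on the order: the derivative is itself given by the
superposition operator of `fderiv ℝ h`. The spaces `H` and `H'` share a universe so that
`H →L[ℝ] H'` is again an admissible target. -/
theorem contDiffOn_superposition_nat.{u} {K : Type*} [TopologicalSpace K] [CompactSpace K]
    {H : Type u} [NormedAddCommGroup H] [NormedSpace ℝ H] {O : Set H} (hO : IsOpen O) (n : ℕ) :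
    ∀ (H' : Type u) [NormedAddCommGroup H'] [NormedSpace ℝ H'] (h : H → H'), ContDiffOn ℝ n h O →
      ContDiffOn ℝ n (superposition (K := K) h) {γ | ∀ s, γ s ∈ O} := by
  induction n with
  | zero =>
    intro H' _ _ h hh
    simp only [CharP.cast_eq_zero, contDiffOn_zero] at hh ⊢
    exact continuousOn_superposition hO hh
  | succ n ih =>
    intro H' _ _ h hh
    push_cast at hh ⊢
    have h1 := hh.of_le (m := 1) (by simp)
    rw [contDiffOn_succ_iff_hasFDerivWithinAt_of_uniqueDiffOn
      (isOpen_setOf_forall_mem hO).uniqueDiffOn]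
    refine ⟨by simp, _, ?_, fun γ hγ => (hasFDerivAt_superposition hO h1 hγ).hasFDerivWithinAt⟩
    exact (pointwiseApply K H H').contDiff.comp_contDiffOn
      (ih _ _ ((contDiffOn_succ_iff_fderiv_of_isOpen hO).1 hh).2.2)

/-- Pointwise evaluation of a continuous multilinear map on continuous functions. -/
noncomputable def pointwiseMultilinear {n : ℕ} (p : H [×n]→L[ℝ] H') :
    C(K, H) [×n]→L[ℝ] C(K, H') :=
  MultilinearMap.mkContinuous
    { toFun := fun γ => ⟨fun s => p fun i => γ i s, by fun_prop⟩
      map_update_add' := fun γ i x y => by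
        ext s
        have (z : C(K, H)) : (fun j => Function.update γ i z j s) =
            Function.update (fun j => γ j s) i (z s) := by
          ext j; by_cases hj : j = i
          · subst hj; simp
          · simp [hj]
        simp [this]
      map_update_smul' := fun γ i c x => by
        ext s
        have (z : C(K, H)) : (fun j => Function.update γ i z j s) =
            Function.update (fun j => γ j s) i (z s) := by
          ext j; by_cases hj : j = i
          · subst hj; simp
          · simp [hj]
        simp [this] } ‖p‖
    (fun γ => by
      simp only [MultilinearMap.coe_mk]
      rw [ContinuousMap.norm_le _ (by positivity)]
      intro s
      refine (p.le_opNorm _).trans ?_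
      gcongr with i
      exact ContinuousMap.norm_coe_le_norm _ s)

/-- At a constant curve, the power series of `h` applied pointwise is a power series of the
superposition operator, with the same bounds. -/
theorem analyticAt_superposition [CompleteSpace H'] {h : H → H'} {x₀ : H}
    (hh : AnalyticAt ℝ h x₀) :
    AnalyticAt ℝ (superposition (K := K) h) (ContinuousMap.const K x₀) := by
  obtain ⟨p, r, hp⟩ := hh
  refine ⟨fun n => pointwiseMultilinear (p n), r, ?_, hp.r_pos, ?_⟩
  · refine hp.r_le.trans (FormalMultilinearSeries.radius_le_of_le fun n => ?_)
    exact MultilinearMap.mkContinuous_norm_le _ (norm_nonneg _) _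
  · intro ζ hζ
    have hmem : ∀ s, ζ s ∈ Metric.eball (0 : H) r := fun s => by
      rw [Metric.mem_eball, edist_zero_right] at hζ ⊢
      refine lt_of_le_of_lt ?_ hζ
      simpa [enorm_le_iff_norm_le] using ζ.norm_coe_le_norm s
    have hc := hp.continuousOn
    have hmem' : ∀ s, (ContinuousMap.const K x₀ + ζ) s ∈ Metric.eball x₀ r := fun s => by
      have := hmem s
      simpa [Metric.mem_eball, edist_eq_enorm_sub] using this
    have hsum : Summable fun n => pointwiseMultilinear (K := K) (p n) fun _ => ζ := by
      have hlt : (‖ζ‖₊ : ENNReal) < p.radius :=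
        lt_of_lt_of_le (by simpa [Metric.mem_eball, edist_zero_right, enorm] using hζ) hp.r_le
      refine Summable.of_norm_bounded (p.summable_norm_mul_pow hlt) fun n => ?_
      refine ((pointwiseMultilinear (K := K) (p n)).le_opNorm _).trans ?_
      simp only [Finset.prod_const, Finset.card_univ, Fintype.card_fin, coe_nnnorm]
      gcongr
      exact MultilinearMap.mkContinuous_norm_le _ (norm_nonneg _) _
    have hlim : superposition h (ContinuousMap.const K x₀ + ζ) =
        ∑' n, pointwiseMultilinear (K := K) (p n) fun _ => ζ := by
      ext s
      rw [superposition_apply hc hmem' s]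
      refine (hp.hasSum (hmem s)).unique ?_
      exact hsum.hasSum.map (ContinuousMap.evalCLM ℝ s : C(K, H') →L[ℝ] H')
        (ContinuousLinearMap.continuous _)
    rw [hlim]
    exact hsum.hasSum

/-- The superposition operator of a smooth or analytic map has the same regularity near a constant
curve. -/
theorem exists_contDiffOn_superposition.{u} {K : Type*} [TopologicalSpace K] [CompactSpace K]
    {H H' : Type u} [NormedAddCommGroup H] [NormedSpace ℝ H] [NormedAddCommGroup H']
    [NormedSpace ℝ H'] [CompleteSpace H'] {r : WithTop ℕ∞} (hr : r = ∞ ∨ r = ω)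
    {O : Set H} (hO : IsOpen O) {x₀ : H} (hx₀ : x₀ ∈ O) {h : H → H'} (hh : ContDiffOn ℝ r h O) :
    ∃ U : Set C(K, H), IsOpen U ∧ ContinuousMap.const K x₀ ∈ U ∧ (∀ γ ∈ U, ∀ s, γ s ∈ O) ∧
      ContDiffOn ℝ r (superposition (K := K) h) U := by
  rcases hr with rfl | rfl
  · exact ⟨{γ | ∀ s, γ s ∈ O}, isOpen_setOf_forall_mem hO, by simpa using fun _ => hx₀,
      fun γ hγ => hγ, contDiffOn_infty.2 fun n =>
        contDiffOn_superposition_nat hO n H' h (contDiffOn_infty.1 hh n)⟩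
  · have ha : AnalyticAt ℝ h x₀ := (hh.contDiffAt (hO.mem_nhds hx₀)).analyticAt
    have hN := (analyticAt_superposition (K := K) ha).eventually_analyticAt
    have hU : ∀ᶠ γ : C(K, H) in 𝓝 (ContinuousMap.const K x₀), ∀ s, γ s ∈ O :=
      (isOpen_setOf_forall_mem hO).mem_nhds (by simpa using fun _ => hx₀)
    obtain ⟨U, hU1, hU2, hU3⟩ := eventually_nhds_iff.1 (hN.and hU)
    exact ⟨U, hU2, hU3, fun γ hγ => (hU1 γ hγ).2,
      fun γ hγ => (hU1 γ hγ).1.contDiffAt.contDiffWithinAt⟩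

end Superposition

/-! ### The inverse function theorem on an open set -/

section InverseFunction

/-- The local inverse of a `C^r` map, `r` being possibly `∞` or `ω`, is `C^r` on an open set. -/
theorem exists_openPartialHomeomorph_contDiffOn {A B : Type*} [NormedAddCommGroup A]
    [NormedSpace ℝ A] [CompleteSpace A] [NormedAddCommGroup B] [NormedSpace ℝ B]
    {r : WithTop ℕ∞} (hr : 1 ≤ r) {O : Set A} (hO : IsOpen O) {a : A} (ha : a ∈ O) {f : A → B}
    (hf : ContDiffOn ℝ r f O) (f' : A ≃L[ℝ] B) (hf' : HasFDerivAt f (f' : A →L[ℝ] B) a) :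
    ∃ e : OpenPartialHomeomorph A B, (⇑e = f) ∧ a ∈ e.source ∧ e.source ⊆ O ∧
      ContDiffOn ℝ r e.symm e.target := by
  have hr0 : r ≠ 0 := (zero_lt_one.trans_le hr).ne'
  have hca := hf.contDiffAt (hO.mem_nhds ha)
  have hcd : ContinuousOn (fderiv ℝ f) O :=
    (hf.of_le hr).continuousOn_fderiv_of_isOpen hO le_rfl
  have hinv : IsOpen (O ∩ fderiv ℝ f ⁻¹' Set.range ((↑) : (A ≃L[ℝ] B) → A →L[ℝ] B)) :=
    hcd.isOpen_inter_preimage hO ContinuousLinearEquiv.isOpen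
  let e₀ := hca.toOpenPartialHomeomorph f hf' hr0
  refine ⟨e₀.restrOpen _ hinv, ?_, ?_, ?_, ?_⟩
  · rfl
  · exact ⟨hca.mem_toOpenPartialHomeomorph_source hf' hr0, ha, by simp [hf'.fderiv]⟩
  · exact fun x hx => hx.2.1
  · intro y hy
    have hs := (e₀.restrOpen _ hinv).map_target hy
    obtain ⟨hyO, g, hg⟩ := hs.2
    refine ContDiffAt.contDiffWithinAt
      ((e₀.restrOpen _ hinv).contDiffAt_symm hy (f₀' := g) ?_ ?_)
    · rw [hg]
      exact ((hf.differentiableOn hr0 _ hyO).differentiableAt (hO.mem_nhds hyO)).hasFDerivAt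
    · exact hf.contDiffAt (hO.mem_nhds hyO)

end InverseFunction

/-! ### Commuting flows -/

section CommutingFlow

open Set

/-- The constant curves, as a continuous linear map. -/
noncomputable def constCurve (H : Type*) [NormedAddCommGroup H] [NormedSpace ℝ H] :
    H →L[ℝ] C(Icc (0 : ℝ) 1, H) :=
  ContinuousLinearMap.const ℝ _

@[simp] theorem constCurve_apply {H : Type*} [NormedAddCommGroup H] [NormedSpace ℝ H] (x : H)
    (t : Icc (0 : ℝ) 1) : constCurve H x t = x := rfl

/-- The primitive `t ↦ ∫₀ᵗ w` of a curve `w` on `[0, 1]`, as a continuous linear map. -/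
noncomputable def primitive (H : Type*) [NormedAddCommGroup H] [NormedSpace ℝ H] :
    C(Icc (0 : ℝ) 1, H) →L[ℝ] C(Icc (0 : ℝ) 1, H) :=
  LinearMap.mkContinuous
    { toFun := fun w => ⟨fun t => ∫ s in (0 : ℝ)..t, w (projIcc 0 1 zero_le_one s), by
        have hw : Continuous fun s : ℝ => w (projIcc 0 1 zero_le_one s) :=
          w.continuous.comp continuous_projIcc
        exact (intervalIntegral.continuous_primitive
          (fun a b => hw.intervalIntegrable a b) 0).comp continuous_subtype_val⟩
      map_add' := fun w w' => by
        ext t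
        exact intervalIntegral.integral_add
          ((w.continuous.comp continuous_projIcc).intervalIntegrable _ _)
          ((w'.continuous.comp continuous_projIcc).intervalIntegrable _ _)
      map_smul' := fun c w => by
        ext t
        exact intervalIntegral.integral_smul c _ } 1
    (fun w => by
      rw [one_mul, ContinuousMap.norm_le _ (by positivity)]
      intro t
      have := intervalIntegral.norm_integral_le_of_norm_le_const (a := 0) (b := (t : ℝ))
        (f := fun s => w (projIcc 0 1 zero_le_one s)) (C := ‖w‖)
        (fun s _ => w.norm_coe_le_norm _)
      refine this.trans ?_
      rw [sub_zero, abs_of_nonneg t.2.1]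
      exact mul_le_of_le_one_right (norm_nonneg _) t.2.2)

theorem primitive_apply {H : Type*} [NormedAddCommGroup H] [NormedSpace ℝ H]
    (w : C(Icc (0 : ℝ) 1, H)) (t : Icc (0 : ℝ) 1) :
    primitive H w t = ∫ s in (0 : ℝ)..t, w (projIcc 0 1 zero_le_one s) := rfl

/-- The curve `s ↦ (v, z s)`, depending continuously and linearly on `(v, z)`. -/
noncomputable def pairCurve (F H : Type*) [NormedAddCommGroup F] [NormedSpace ℝ F]
    [NormedAddCommGroup H] [NormedSpace ℝ H] :
    F × C(Icc (0 : ℝ) 1, H) →L[ℝ] C(Icc (0 : ℝ) 1, F × H) :=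
  ((ContinuousLinearMap.inl ℝ F H).compLeftContinuous ℝ (Icc (0 : ℝ) 1) ∘L constCurve F).coprod
    ((ContinuousLinearMap.inr ℝ F H).compLeftContinuous ℝ (Icc (0 : ℝ) 1))

@[simp] theorem pairCurve_apply {F H : Type*} [NormedAddCommGroup F] [NormedSpace ℝ F]
    [NormedAddCommGroup H] [NormedSpace ℝ H] (q : F × C(Icc (0 : ℝ) 1, H)) (t : Icc (0 : ℝ) 1) :
    pairCurve F H q t = (q.1, q.2 t) := by
  simp [pairCurve, ContinuousLinearMap.compLeftContinuous]

theorem hasFDerivAt_evalField {F H : Type*} [NormedAddCommGroup F] [NormedSpace ℝ F]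
    [NormedAddCommGroup H] [NormedSpace ℝ H] {T : H → F →L[ℝ] H} {q : F × H}
    (hT : DifferentiableAt ℝ T q.2) :
    HasFDerivAt (fun q : F × H => T q.2 q.1)
      ((T q.2) ∘L (ContinuousLinearMap.fst ℝ F H) +
        (fderiv ℝ T q.2 ∘L ContinuousLinearMap.snd ℝ F H).flip q.1) q :=
  (hT.hasFDerivAt.comp q hasFDerivAt_snd).clm_apply hasFDerivAt_fst

/-- Along a solution `z` of `z' = T z v`, the field `t ↦ t • T (z t) δ` solves the linearization of
the equation in the direction `δ`: this is where the symmetry of `DT (T a) b` enters. -/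
theorem primitive_variation {F H : Type*} [NormedAddCommGroup F] [NormedSpace ℝ F]
    [NormedAddCommGroup H] [NormedSpace ℝ H] [CompleteSpace H] {O : Set H} (hO : IsOpen O)
    {T : H → F →L[ℝ] H} (hT : ContDiffOn ℝ 1 T O)
    (hsymm : ∀ x ∈ O, ∀ a b, fderiv ℝ T x (T x a) b = fderiv ℝ T x (T x b) a)
    {z : C(Icc (0 : ℝ) 1, H)} (hz : ∀ t, z t ∈ O) {v δ : F} {y : H}
    {φ w u : C(Icc (0 : ℝ) 1, H)} (hφ : ∀ t, φ t = T (z t) v)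
    (hzφ : z = constCurve H y + primitive H φ)
    (hu : ∀ t, u t = (t : ℝ) • T (z t) δ)
    (hw : ∀ t, w t = T (z t) δ + fderiv ℝ T (z t) (u t) v) :
    u = primitive H w := by
  set p : ℝ → Icc (0 : ℝ) 1 := projIcc 0 1 zero_le_one with hp
  have hpc : Continuous p := continuous_projIcc
  have hpt : ∀ t : Icc (0 : ℝ) 1, p t = t := fun t => projIcc_val zero_le_one t
  have hTc : ∀ x ∈ O, HasFDerivAt T (fderiv ℝ T x) x := fun x hx =>
    ((hT.differentiableOn one_ne_zero x hx).differentiableAt (hO.mem_nhds hx)).hasFDerivAt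
  have hzp : ∀ s ∈ Ioo (0 : ℝ) 1, HasDerivAt (fun s => z (p s)) (φ (p s)) s := by
    intro s hs
    have h1 : HasDerivAt (fun t => y + ∫ s in (0 : ℝ)..t, φ (p s)) (φ (p s)) s :=
      (intervalIntegral.integral_hasDerivAt_right
        ((φ.continuous.comp hpc).intervalIntegrable _ _)
        ((φ.continuous.comp hpc).stronglyMeasurableAtFilter _ _)
        (φ.continuous.comp hpc).continuousAt).const_add y
    refine h1.congr_of_eventuallyEq ?_
    filter_upwards [isOpen_Ioo.mem_nhds hs] with t ht
    conv_lhs => rw [hzφ]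
    have : ((p t : Icc (0 : ℝ) 1) : ℝ) = t := by
      rw [hp, projIcc_of_mem zero_le_one ⟨ht.1.le, ht.2.le⟩]
    simp only [ContinuousMap.add_apply, constCurve_apply, primitive_apply, this]
    rfl
  ext t
  rw [primitive_apply]
  have key := intervalIntegral.integral_eq_sub_of_hasDerivAt_of_le (a := 0) (b := (t : ℝ))
    (f := fun s => u (p s)) (f' := fun s => w (p s)) t.2.1
    (u.continuous.comp hpc).continuousOn ?_ ((w.continuous.comp hpc).intervalIntegrable _ _)
  · rw [key, hpt]
    have h0 : ((p 0 : Icc (0 : ℝ) 1) : ℝ) = 0 := by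
      rw [hp, projIcc_of_mem zero_le_one ⟨le_rfl, zero_le_one⟩]
    simp [hu (p 0), h0]
  · intro s hs
    have hs' : s ∈ Ioo (0 : ℝ) 1 := ⟨hs.1, hs.2.trans_le t.2.2⟩
    have hps : ∀ s ∈ Ioo (0 : ℝ) 1, ((p s : Icc (0 : ℝ) 1) : ℝ) = s := fun s hs => by
      rw [hp, projIcc_of_mem zero_le_one ⟨hs.1.le, hs.2.le⟩]
    have h1 : HasDerivAt (fun s => T (z (p s))) (fderiv ℝ T (z (p s)) (φ (p s))) s :=
      (hTc _ (hz _)).comp_hasDerivAt s (hzp s hs')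
    have h2 : HasDerivAt (fun s => s • T (z (p s)) δ)
        (s • (fderiv ℝ T (z (p s)) (φ (p s)) δ) + (1 : ℝ) • T (z (p s)) δ) s := by
      have h3 := h1.clm_apply (hasDerivAt_const s δ)
      simp only [map_zero, add_zero] at h3
      exact (hasDerivAt_id s).smul h3
    have h4 : HasDerivAt (fun s => u (p s))
        (s • (fderiv ℝ T (z (p s)) (φ (p s)) δ) + (1 : ℝ) • T (z (p s)) δ) s := by
      refine h2.congr_of_eventuallyEq ?_
      filter_upwards [isOpen_Ioo.mem_nhds hs'] with t ht
      rw [hu, hps t ht]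
    convert h4 using 1
    rw [hw, hu, hps s hs', hφ, hsymm _ (hz _), one_smul, add_comm]
    simp

/-- A field of linear maps `T x : F → H` whose columns commute has a joint flow of the regularity of
`T`: a map `η` with `η (0, y) = y` and `∂η/∂v (v, y) = T (η (v, y))`. Here `η (v, y)` is the value
at time `1` of the solution of `z' = T z v` with `z 0 = y`. The space `F` lives in `Type` so that
`F × H` is in the universe of `H`. -/
theorem exists_commuting_flow.{u} {F : Type} {H : Type u} [NormedAddCommGroup F] [NormedSpace ℝ F]
    [CompleteSpace F] [NormedAddCommGroup H] [NormedSpace ℝ H] [CompleteSpace H]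
    {r : WithTop ℕ∞} (hr : r = ∞ ∨ r = ω) {O : Set H} (hO : IsOpen O) {x₀ : H} (hx₀ : x₀ ∈ O)
    {T : H → F →L[ℝ] H} (hT : ContDiffOn ℝ r T O)
    (hsymm : ∀ x ∈ O, ∀ a b, fderiv ℝ T x (T x a) b = fderiv ℝ T x (T x b) a) :
    ∃ (Ω : Set (F × H)) (η : F × H → H), IsOpen Ω ∧ (0, x₀) ∈ Ω ∧ ContDiffOn ℝ r η Ω ∧
      (∀ q ∈ Ω, η q ∈ O) ∧ (∀ y, (0, y) ∈ Ω → η (0, y) = y) ∧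
      ∀ q ∈ Ω, ∀ a, fderiv ℝ η q (a, 0) = T (η q) a := by
  have hr1 : 1 ≤ r := by rcases hr with rfl | rfl <;> simp
  have hr0 : r ≠ 0 := (zero_lt_one.trans_le hr1).ne'
  have hT1 : ContDiffOn ℝ 1 T O := hT.of_le hr1
  have hTd : ∀ x ∈ O, DifferentiableAt ℝ T x := fun x hx =>
    (hT1.differentiableOn one_ne_zero x hx).differentiableAt (hO.mem_nhds hx)
  set h : F × H → H := fun q => T q.2 q.1
  have hO' : IsOpen (univ ×ˢ O : Set (F × H)) := isOpen_univ.prod hO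
  have hh : ContDiffOn ℝ r h (univ ×ˢ O) :=
    (hT.comp contDiffOn_snd fun q hq => hq.2).clm_apply contDiffOn_fst
  have hfd : ∀ q ∈ (univ ×ˢ O : Set (F × H)), ∀ ζ, fderiv ℝ h q ζ =
      T q.2 ζ.1 + fderiv ℝ T q.2 ζ.2 q.1 := fun q hq ζ => by
    rw [(hasFDerivAt_evalField (hTd _ hq.2)).fderiv]; simp
  have hfdc : ContinuousOn (fderiv ℝ h) (univ ×ˢ O) :=
    (hh.of_le hr1).continuousOn_fderiv_of_isOpen hO' le_rfl
  obtain ⟨U, hU, hU₀, hUO, hUs⟩ := exists_contDiffOn_superposition (K := Icc (0 : ℝ) 1) hr hO'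
    (x₀ := ((0 : F), x₀)) ⟨mem_univ _, hx₀⟩ hh
  let C := C(Icc (0 : ℝ) 1, H)
  -- the curve `s ↦ (v, z s)` attached to `((v, y), z)`
  let π : (F × H) × C →L[ℝ] C(Icc (0 : ℝ) 1, F × H) :=
    pairCurve F H ∘L ((ContinuousLinearMap.fst ℝ F H).prodMap (ContinuousLinearMap.id ℝ C))
  have hπ : ∀ q t, π q t = (q.1.1, q.2 t) := fun q t => by simp [π]
  -- `Φ ((v, y), z) = ((v, y), 0)` says that `z` is the integral curve of `T v` issued from `y`
  let Φ : (F × H) × C → (F × H) × C := fun q =>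
    (q.1, q.2 - constCurve H q.1.2 - primitive H (superposition h (π q)))
  set W : Set ((F × H) × C) := π ⁻¹' U
  have hW : IsOpen W := hU.preimage π.continuous
  set a : (F × H) × C := ((0, x₀), ContinuousMap.const _ x₀)
  have hπa : π a = ContinuousMap.const _ ((0 : F), x₀) := by
    ext t
    · simp [hπ, a]
    · simp only [hπ, a]; rfl
  have haW : a ∈ W := by simpa [W, hπa] using hU₀
  have hΦ : ContDiffOn ℝ r Φ W := by
    refine contDiffOn_fst.prodMk ((contDiffOn_snd.sub ?_).sub ?_)
    · exact ((constCurve H).contDiff.comp (contDiff_snd.comp contDiff_fst)).contDiffOn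
    · exact (primitive H).contDiff.comp_contDiffOn
        (hUs.comp π.contDiff.contDiffOn fun q hq => hq)
  have hWO : ∀ q ∈ W, ∀ t, q.2 t ∈ O := fun q hq t => by
    have := (hUO _ hq t).2; rwa [hπ] at this
  have hΦ' : ∀ q ∈ W, HasFDerivAt Φ ((ContinuousLinearMap.fst ℝ (F × H) C).prod
      (ContinuousLinearMap.snd ℝ (F × H) C -
        constCurve H ∘L (ContinuousLinearMap.snd ℝ F H) ∘L (ContinuousLinearMap.fst ℝ (F × H) C) -
        primitive H ∘L (pointwiseApply _ _ _ (superposition (fderiv ℝ h) (π q))) ∘L π)) q := by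
    intro q hq
    refine hasFDerivAt_fst.prodMk ((hasFDerivAt_snd.sub ?_).sub ?_)
    · exact ((constCurve H).hasFDerivAt.comp q (hasFDerivAt_snd.comp q hasFDerivAt_fst))
    · exact (primitive H).hasFDerivAt.comp q
        ((hasFDerivAt_superposition hO' (hh.of_le hr1) (hUO _ hq)).comp q π.hasFDerivAt)
  have hlin : ∀ q ∈ W, ∀ ζ : (F × H) × C, ∀ t,
      pointwiseApply _ _ _ (superposition (fderiv ℝ h) (π q)) (π ζ) t =
        T (q.2 t) ζ.1.1 + fderiv ℝ T (q.2 t) (ζ.2 t) q.1.1 := by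
    intro q hq ζ t
    rw [pointwiseApply_apply, superposition_apply hfdc (hUO _ hq), hfd _ (hUO _ hq t), hπ, hπ]
  -- at `v = 0` the derivative is a shear, hence invertible
  let Φ'a : ((F × H) × C) ≃L[ℝ] (F × H) × C :=
    (ContinuousLinearEquiv.refl ℝ (F × H)).skewProd (ContinuousLinearEquiv.refl ℝ C)
      (-(constCurve H ∘L (ContinuousLinearMap.snd ℝ F H)) -
        primitive H ∘L (pointwiseApply _ _ _ (superposition (fderiv ℝ h) (π a))) ∘L π ∘L
          (ContinuousLinearMap.inl ℝ (F × H) C))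
  have hΦa : HasFDerivAt Φ (Φ'a : (F × H) × C →L[ℝ] (F × H) × C) a := by
    convert hΦ' a haW using 1
    have h0 : ∀ ζ : (F × H) × C, pointwiseApply _ _ _ (superposition (fderiv ℝ h) (π a)) (π ζ) =
        pointwiseApply _ _ _ (superposition (fderiv ℝ h) (π a)) (π (ζ.1, 0)) := by
      intro ζ
      ext t
      rw [hlin a haW, hlin a haW]
      simp [a]
    refine ContinuousLinearMap.ext fun ζ => Prod.ext ?_ ?_
    · simp [Φ'a]
    · simp [Φ'a, h0 ζ]
      abel
  obtain ⟨e, he, hae, heW, hsymm_e⟩ :=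
    exists_openPartialHomeomorph_contDiffOn hr1 hW haW hΦ Φ'a hΦa
  let ι : F × H →L[ℝ] (F × H) × C := ContinuousLinearMap.inl ℝ (F × H) C
  let Ω : Set (F × H) := ι ⁻¹' e.target
  let Z : F × H → C := fun q => (e.symm (ι q)).2
  have hΩ : IsOpen Ω := e.open_target.preimage ι.continuous
  have hZ : ContDiffOn ℝ r Z Ω :=
    contDiff_snd.comp_contDiffOn (hsymm_e.comp ι.contDiff.contDiffOn fun q hq => hq)
  have hsrc : ∀ q ∈ Ω, e.symm (ι q) ∈ e.source := fun q hq => e.map_target hq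
  have hΦZ : ∀ q ∈ Ω, Φ (e.symm (ι q)) = ι q := fun q hq => by
    rw [← he]; exact e.right_inv hq
  have hpair : ∀ q ∈ Ω, e.symm (ι q) = (q, Z q) := fun q hq => by
    refine Prod.ext ?_ rfl
    have := congrArg Prod.fst (hΦZ q hq)
    simpa [Φ, ι] using this
  have hqW : ∀ q ∈ Ω, (q, Z q) ∈ W := fun q hq => hpair q hq ▸ heW (hsrc q hq)
  have hZO : ∀ q ∈ Ω, ∀ t, Z q t ∈ O := fun q hq => hWO (q, Z q) (hqW q hq)
  have hZeq : ∀ q ∈ Ω, Z q = constCurve H q.2 + primitive H (superposition h (π (q, Z q))) := by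
    intro q hq
    have := congrArg Prod.snd (hΦZ q hq)
    rw [hpair q hq] at this
    simp only [Φ, ι, ContinuousLinearMap.inl_apply] at this
    rw [sub_sub, sub_eq_zero] at this
    exact this
  have hsup : ∀ q ∈ Ω, ∀ t, superposition h (π (q, Z q)) t = T (Z q t) q.1 := fun q hq t => by
    rw [superposition_apply hh.continuousOn (hUO _ (hqW q hq)), hπ]
  have h1mem : (1 : ℝ) ∈ Icc (0 : ℝ) 1 := ⟨zero_le_one, le_rfl⟩
  refine ⟨Ω, fun q => Z q ⟨1, h1mem⟩, hΩ, ?_, ?_, fun q hq => hZO q hq _, ?_, ?_⟩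
  · -- `Φ` fixes the constant curve through `x₀`
    have : ι (0, x₀) = e a := by
      have h0 : superposition h (π a) = 0 := by
        ext t
        rw [superposition_apply hh.continuousOn (hUO _ haW), hπ]
        simp [h, a]
      rw [he]
      simp only [Φ, h0, map_zero, ι, ContinuousLinearMap.inl_apply]
      refine Prod.ext rfl ?_
      ext t
      rw [sub_zero]
      exact (sub_self x₀).symm
    change ι (0, x₀) ∈ e.target
    rw [this]
    exact e.map_source hae
  · exact (ContinuousMap.evalCLM ℝ (⟨1, h1mem⟩ : Icc (0 : ℝ) 1) :
      C →L[ℝ] H).contDiff.comp_contDiffOn hZ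
  · intro y hy
    have h0 : superposition h (π ((0, y), Z (0, y))) = 0 := by
      ext t
      rw [hsup _ hy]; simp
    change Z (0, y) _ = y
    rw [hZeq _ hy, h0, map_zero, add_zero]
    rfl
  · intro q hq δ
    have hZd : HasFDerivAt Z (fderiv ℝ Z q) q :=
      ((hZ.differentiableOn hr0 q hq).differentiableAt (hΩ.mem_nhds hq)).hasFDerivAt
    set w : C := fderiv ℝ Z q (δ, 0)
    -- the candidate for the derivative of the curve in the direction `δ`
    have hTZ : Continuous fun t => T (Z q t) := hT.continuousOn.comp_continuous (Z q).continuous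
      (hZO q hq)
    let u : C := ⟨fun t => (t : ℝ) • T (Z q t) δ,
      continuous_subtype_val.smul (hTZ.clm_apply continuous_const)⟩
    -- the linearized integral operator
    set Λ : (F × H) × C →L[ℝ] C :=
      primitive H ∘L (pointwiseApply _ _ _ (superposition (fderiv ℝ h) (π (q, Z q)))) ∘L π
    have hwΛ : w = Λ ((δ, 0), w) := by
      have h1 : HasFDerivAt (fun q => Φ (q, Z q))
          (_ ∘L (ContinuousLinearMap.id ℝ (F × H)).prod (fderiv ℝ Z q)) q :=
        (hΦ' _ (hqW q hq)).comp q ((hasFDerivAt_id q).prodMk hZd)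
      have h2 : HasFDerivAt (fun q => Φ (q, Z q)) ι q := by
        refine ι.hasFDerivAt.congr_of_eventuallyEq ?_
        filter_upwards [hΩ.mem_nhds hq] with q' hq'
        rw [← hpair q' hq', hΦZ q' hq']
      have h3 := congrArg Prod.snd (DFunLike.congr_fun (h1.unique h2) (δ, 0))
      simp only [ContinuousLinearMap.comp_apply, ContinuousLinearMap.prod_apply,
        sub_apply, ContinuousLinearMap.coe_fst', ContinuousLinearMap.coe_snd',
        ContinuousLinearMap.id_apply, map_zero, sub_zero, ι, ContinuousLinearMap.inl_apply] at h3
      exact sub_eq_zero.1 h3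
    have huΛ : u = Λ ((δ, 0), u) := by
      refine primitive_variation hO hT1 hsymm (hZO q hq) (v := q.1) (δ := δ) (y := q.2)
        (hsup q hq) (hZeq q hq) (fun t => rfl) (fun t => ?_)
      exact hlin _ (hqW q hq) ((δ, 0), u) t
    -- the linearized equation has only one solution, as the derivative of `Φ` has a left inverse
    have huw : w = u := by
      have hg : HasFDerivAt e.symm (fderiv ℝ e.symm (ι q)) (Φ (q, Z q)) := by
        rw [← hpair q hq, hΦZ q hq]
        exact ((hsymm_e.differentiableOn hr0 _ hq).differentiableAt
          (e.open_target.mem_nhds hq)).hasFDerivAt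
      have h1 : HasFDerivAt (fun q' => e.symm (Φ q')) (_ ∘L _) (q, Z q) :=
        hg.comp (q, Z q) (hΦ' _ (hqW q hq))
      have h2 : HasFDerivAt (fun q' => e.symm (Φ q')) (ContinuousLinearMap.id ℝ ((F × H) × C))
          (q, Z q) := by
        refine (hasFDerivAt_id _).congr_of_eventuallyEq ?_
        filter_upwards [e.open_source.mem_nhds (hpair q hq ▸ hsrc q hq)] with q' hq'
        rw [← he]; exact e.left_inv hq'
      have h3 := DFunLike.congr_fun (h1.unique h2) ((0, 0), w - u)
      have h4 : Λ ((0, 0), w - u) = w - u := by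
        conv_rhs => rw [hwΛ, huΛ, ← map_sub]
        simp only [Prod.mk_sub_mk, sub_self]
        rfl
      have h5 : w - u - constCurve H 0 - Λ ((0, 0), w - u) = 0 := by
        rw [h4, map_zero, sub_zero, sub_self]
      have h6 : fderiv ℝ e.symm (ι q)
          (((0, 0) : F × H), w - u - constCurve H 0 - Λ ((0, 0), w - u)) = ((0, 0), w - u) := h3
      rw [h5] at h6
      have h7 : ((((0, 0) : F × H), (0 : C))) = 0 := rfl
      rw [h7, map_zero] at h6
      exact sub_eq_zero.1 (congrArg Prod.snd h6).symm
    have hev : HasFDerivAt (fun q => Z q ⟨1, h1mem⟩)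
        ((ContinuousMap.evalCLM ℝ (⟨1, h1mem⟩ : Icc (0 : ℝ) 1) : C →L[ℝ] H) ∘L fderiv ℝ Z q) q :=
      (ContinuousMap.evalCLM ℝ (⟨1, h1mem⟩ : Icc (0 : ℝ) 1) : C →L[ℝ] H).hasFDerivAt.comp q hZd
    rw [hev.fderiv]
    change w _ = _
    rw [huw]
    exact one_smul ℝ _

/-- Local solvability of the overdetermined system `DP(x) (T x a) = B (x, P x) a`, under the
integrability conditions expressing that the columns of the field `(T, B)` commute. -/
theorem exists_solution_along_frame.{u} {F V : Type} {E : Type u} [NormedAddCommGroup F]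
    [NormedSpace ℝ F] [CompleteSpace F] [NormedAddCommGroup V] [NormedSpace ℝ V] [CompleteSpace V]
    [NormedAddCommGroup E] [NormedSpace ℝ E] [CompleteSpace E]
    {r : WithTop ℕ∞} (hr : r = ∞ ∨ r = ω) {O : Set E} (hO : IsOpen O) {x₀ : E} (hx₀ : x₀ ∈ O)
    {T : E → F →L[ℝ] E} (hT : ContDiffOn ℝ r T O)
    {B : E × V → F →L[ℝ] V} (hB : ContDiffOn ℝ r B (O ×ˢ univ))
    (hTsymm : ∀ x ∈ O, ∀ a b, fderiv ℝ T x (T x a) b = fderiv ℝ T x (T x b) a)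
    (hBsymm : ∀ x ∈ O, ∀ P a b, fderiv ℝ B (x, P) (T x a, B (x, P) a) b =
      fderiv ℝ B (x, P) (T x b, B (x, P) b) a)
    {ℓ : E →L[ℝ] F} (hℓ : ∀ a, ℓ (T x₀ a) = a) (P₀ : V) :
    ∃ (O' : Set E) (P : E → V), IsOpen O' ∧ x₀ ∈ O' ∧ O' ⊆ O ∧ ContDiffOn ℝ r P O' ∧ P x₀ = P₀ ∧
      ∀ x ∈ O', ∀ a, fderiv ℝ P x (T x a) = B (x, P x) a := by
  have hr1 : 1 ≤ r := by rcases hr with rfl | rfl <;> simp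
  have hr0 : r ≠ 0 := (zero_lt_one.trans_le hr1).ne'
  have hOV : IsOpen (O ×ˢ univ : Set (E × V)) := hO.prod isOpen_univ
  -- the field whose integral leaves are swept out by the graphs of solutions
  let S : E × V → F →L[ℝ] E × V := fun z => (T z.1).prod (B z)
  have hS : ContDiffOn ℝ r S (O ×ˢ univ) :=
    (ContinuousLinearMap.prodₗᵢ (𝕜 := ℝ) (E := F) (F := E) (G := V)
      ℝ).toContinuousLinearEquiv.contDiff.comp_contDiffOn
      ((hT.comp contDiffOn_fst fun q hq => hq.1).prodMk hB)
  have hTd : ∀ x ∈ O, DifferentiableAt ℝ T x := fun x hx =>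
    (hT.differentiableOn hr0 x hx).differentiableAt (hO.mem_nhds hx)
  have hBd : ∀ z ∈ (O ×ˢ univ : Set (E × V)), DifferentiableAt ℝ B z := fun z hz =>
    (hB.differentiableOn hr0 z hz).differentiableAt (hOV.mem_nhds hz)
  have hSd : ∀ z ∈ (O ×ˢ univ : Set (E × V)), ∀ ζ b,
      fderiv ℝ S z ζ b = (fderiv ℝ T z.1 ζ.1 b, fderiv ℝ B z ζ b) := by
    intro z hz ζ b
    have h1 : HasFDerivAt S _ z :=
      (ContinuousLinearMap.prodₗᵢ (𝕜 := ℝ) (E := F) (F := E) (G := V)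
        ℝ).toContinuousLinearEquiv.hasFDerivAt.comp z
        (((hTd _ hz.1).hasFDerivAt.comp z hasFDerivAt_fst).prodMk (hBd z hz).hasFDerivAt)
    rw [h1.fderiv]
    rfl
  obtain ⟨Ω, η, hΩ, h0Ω, hη, hηO, hη0, hηd⟩ := exists_commuting_flow hr hOV
    (x₀ := (x₀, P₀)) ⟨hx₀, mem_univ _⟩ hS (by
      rintro ⟨x, P⟩ hz a b
      rw [hSd _ hz, hSd _ hz]
      exact Prod.ext (hTsymm x hz.1 a b) (hBsymm x hz.1 P a b))
  have hηdiff : ∀ q ∈ Ω, DifferentiableAt ℝ η q := fun q hq =>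
    (hη.differentiableOn hr0 q hq).differentiableAt (hΩ.mem_nhds hq)
  -- flow out of the affine transversal `x₀ + ker ℓ`
  let k : E →L[ℝ] F × (E × V) :=
    ℓ.prod ((ContinuousLinearMap.id ℝ E - (T x₀) ∘L ℓ).prod 0)
  let κ : E → F × (E × V) := fun x => (0, (x₀, P₀)) + k (x - x₀)
  have hκ : ContDiff ℝ r κ := contDiff_const.add (k.contDiff.comp (contDiff_id.sub contDiff_const))
  have hκd : ∀ x, HasFDerivAt κ k x := fun x =>
    ((k.hasFDerivAt.comp x ((hasFDerivAt_id x).sub_const x₀)).const_add _)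
  have hκ0 : κ x₀ = (0, (x₀, P₀)) := by simp [κ]
  have hkT : ∀ a, k (T x₀ a) = (a, 0) := fun a => by simp [k, hℓ]
  let Ψ : E → E × V := fun x => η (κ x)
  set W : Set E := κ ⁻¹' Ω
  have hW : IsOpen W := hΩ.preimage hκ.continuous
  have hx₀W : x₀ ∈ W := by simpa [W, hκ0] using h0Ω
  have hΨ : ContDiffOn ℝ r Ψ W := hη.comp hκ.contDiffOn fun x hx => hx
  have hΨd : ∀ x ∈ W, HasFDerivAt Ψ (fderiv ℝ η (κ x) ∘L k) x := fun x hx =>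
    (hηdiff _ hx).hasFDerivAt.comp x (hκd x)
  have hΨT : ∀ x ∈ W, ∀ a, fderiv ℝ Ψ x (T x₀ a) = S (Ψ x) a := fun x hx a => by
    rw [(hΨd x hx).fderiv, ContinuousLinearMap.comp_apply, hkT, hηd _ hx]
  have hΨ0 : Ψ x₀ = (x₀, P₀) := by
    change η (κ x₀) = _
    rw [hκ0, hη0 _ h0Ω]
  have hη_base : ∀ ζ, fderiv ℝ η (0, (x₀, P₀)) (0, ζ) = ζ := by
    intro ζ
    have h1 : HasFDerivAt (fun y => η (0, y))
        (fderiv ℝ η (0, (x₀, P₀)) ∘L ContinuousLinearMap.inr ℝ F (E × V)) (x₀, P₀) :=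
      (hηdiff _ h0Ω).hasFDerivAt.comp (x₀, P₀) (hasFDerivAt_prodMk_right 0 (x₀, P₀))
    have h2 : HasFDerivAt (fun y => η (0, y)) (ContinuousLinearMap.id ℝ (E × V)) (x₀, P₀) := by
      refine (hasFDerivAt_id _).congr_of_eventuallyEq ?_
      have : ∀ᶠ y in 𝓝 (x₀, P₀), ((0 : F), y) ∈ Ω :=
        (Continuous.prodMk_right (0 : F)).continuousAt.eventually_mem (hΩ.mem_nhds h0Ω)
      filter_upwards [this] with y hy
      exact hη0 y hy
    exact DFunLike.congr_fun (h1.unique h2) ζ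
  -- the projection of the flow to `E` is a local diffeomorphism
  have hΘd : HasFDerivAt (fun x => (Ψ x).1)
      ((ContinuousLinearEquiv.refl ℝ E : E ≃L[ℝ] E) : E →L[ℝ] E) x₀ := by
    refine HasFDerivAt.congr_fderiv (hasFDerivAt_fst.comp x₀ (hΨd x₀ hx₀W)) ?_
    ext δ
    have h1 : k δ = (ℓ δ, 0) + (0, (δ - T x₀ (ℓ δ), 0)) := by simp [k]
    have h2 := hηd _ h0Ω (ℓ δ)
    change (fderiv ℝ η (κ x₀) (k δ)).1 = δ
    rw [hκ0, h1, map_add, h2, hη_base, hη0 _ h0Ω]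
    simp [S]
  obtain ⟨e, he, hxe, heW, hes⟩ := exists_openPartialHomeomorph_contDiffOn hr1 hW hx₀W
    (contDiff_fst.comp_contDiffOn hΨ) _ hΘd
  have he' : ∀ x, e x = (Ψ x).1 := fun x => congrFun he x
  have hex₀ : e x₀ = x₀ := by rw [he', hΨ0]
  have hsymmW : ∀ x ∈ e.target, e.symm x ∈ W := fun x hx => heW (e.map_target hx)
  refine ⟨e.target, fun x => (Ψ (e.symm x)).2, e.open_target, ?_, ?_, ?_, ?_, ?_⟩
  · have := e.map_source hxe
    rwa [hex₀] at this
  · intro x hx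
    have h1 := (hηO _ (hsymmW x hx)).1
    have h2 := e.right_inv hx
    rw [he'] at h2
    rwa [← h2]
  · exact contDiff_snd.comp_contDiffOn (hΨ.comp hes hsymmW)
  · have h1 := e.left_inv hxe
    rw [hex₀] at h1
    change (Ψ (e.symm x₀)).2 = P₀
    rw [h1, hΨ0]
  · intro x hx a
    set y := e.symm x with hy
    have hyW : y ∈ W := hsymmW x hx
    have hyx : (Ψ y).1 = x := by rw [← he', hy, e.right_inv hx]
    have hP : HasFDerivAt (fun x => (Ψ (e.symm x)).2)
        (fderiv ℝ (fun x => (Ψ (e.symm x)).2) x) ((Ψ y).1) := by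
      rw [hyx]
      exact (((contDiff_snd.comp_contDiffOn (hΨ.comp hes hsymmW)).differentiableOn hr0 x
        hx).differentiableAt (e.open_target.mem_nhds hx)).hasFDerivAt
    have hΨy : HasFDerivAt Ψ (fderiv ℝ Ψ y) y := (hΨd y hyW).differentiableAt.hasFDerivAt
    have h1 := hP.comp y (hasFDerivAt_fst.comp y hΨy)
    have h2 : HasFDerivAt ((fun x => (Ψ (e.symm x)).2) ∘ (Prod.fst ∘ Ψ))
        (ContinuousLinearMap.snd ℝ E V ∘L fderiv ℝ Ψ y) y := by
      refine (hasFDerivAt_snd.comp y hΨy).congr_of_eventuallyEq ?_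
      filter_upwards [e.open_source.mem_nhds (e.map_target hx)] with x' hx'
      simp only [Function.comp_apply, ← he', e.left_inv hx']
    have h3 := DFunLike.congr_fun (h1.unique h2) (T x₀ a)
    simp only [ContinuousLinearMap.comp_apply, hΨT y hyW] at h3
    have h4 : Ψ y = (x, (Ψ y).2) := Prod.ext hyx rfl
    simp only [S, ContinuousLinearMap.prod_apply, ContinuousLinearMap.coe_fst',
      ContinuousLinearMap.coe_snd', hyx] at h3
    rw [h3, h4]

end CommutingFlow

/-! ### Flatness of the partial connection defined by a system -/

section AdaptedFrame

open Set VectorField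

variable {E F : Type*} [NormedAddCommGroup E] [NormedSpace ℝ E] [NormedAddCommGroup F]
  [NormedSpace ℝ F] {ι : Type*} [Fintype ι]

theorem add_one_le_of_eq_infty_or_omega {r : WithTop ℕ∞} (hr : r = ∞ ∨ r = ω) : r + 1 ≤ r := by
  rcases hr with rfl | rfl <;> exact le_rfl

theorem one_le_of_eq_infty_or_omega {r : WithTop ℕ∞} (hr : r = ∞ ∨ r = ω) : 1 ≤ r := by
  rcases hr with rfl | rfl <;> simp

theorem contDiffOn_lieBracket {r : WithTop ℕ∞} (hr : r = ∞ ∨ r = ω) {O : Set E} (hO : IsOpen O)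
    {V W : E → E} (hV : ContDiffOn ℝ r V O) (hW : ContDiffOn ℝ r W O) :
    ContDiffOn ℝ r (lieBracket ℝ V W) O := by
  have h := add_one_le_of_eq_infty_or_omega hr
  exact ((hW.fderiv_of_isOpen hO h).clm_apply hV).sub ((hV.fderiv_of_isOpen hO h).clm_apply hW)

theorem lieBracket_congr_nhds {V V' W W' : E → E} {x : E} (hV : V =ᶠ[𝓝 x] V')
    (hW : W =ᶠ[𝓝 x] W') : lieBracket ℝ V W x = lieBracket ℝ V' W' x := by
  simp only [lieBracket, hV.fderiv_eq, hW.fderiv_eq, hV.eq_of_nhds, hW.eq_of_nhds]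

theorem lieBracket_clm_apply_right {h : E → E} {X : E → F →L[ℝ] E} {c : E → F} {x : E}
    (hX : DifferentiableAt ℝ X x) (hc : DifferentiableAt ℝ c x) :
    lieBracket ℝ h (fun y => X y (c y)) x =
      lieBracket ℝ h (fun y => X y (c x)) x + X x (fderiv ℝ c x (h x)) := by
  have h1 := (hX.hasFDerivAt.clm_apply hc.hasFDerivAt).fderiv
  have h2 := (hX.hasFDerivAt.clm_apply (hasFDerivAt_const (c x) x)).fderiv
  simp only [lieBracket, h1, h2]
  simp
  abel

theorem lieBracket_clm_apply_left {h : E → E} {X : E → F →L[ℝ] E} {c : E → F} {x : E}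
    (hX : DifferentiableAt ℝ X x) (hc : DifferentiableAt ℝ c x) :
    lieBracket ℝ (fun y => X y (c y)) h x =
      lieBracket ℝ (fun y => X y (c x)) h x - X x (fderiv ℝ c x (h x)) := by
  rw [lieBracket_swap, lieBracket_clm_apply_right hX hc, lieBracket_swap (V := h), neg_add_rev,
    neg_neg]
  abel

/-- A commuting frame `T` together with fields `g i` independent of it modulo the distribution
`range T`, and maps picking out coefficients: `ℓ` is a constant left inverse of `T`, and `γ` gives
the coefficients along the `g i` of the vectors in `range T ⊕ span g`. The last condition says that
the brackets of `T` and `g` stay in `range T ⊕ span g`. -/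
structure AdaptedFrame (r : WithTop ℕ∞) (O : Set E) (T : E → F →L[ℝ] E) (g : ι → E → E)
    (γ : E → E →L[ℝ] (ι → ℝ)) (ℓ : E →L[ℝ] F) : Prop where
  contDiffOn_frame : ContDiffOn ℝ r T O
  contDiffOn_input : ∀ i, ContDiffOn ℝ r (g i) O
  contDiffOn_coeff : ContDiffOn ℝ r γ O
  left_inv : ∀ x ∈ O, ∀ a, ℓ (T x a) = a
  coeff_frame : ∀ x ∈ O, ∀ a, γ x (T x a) = 0
  coeff_sum : ∀ x ∈ O, ∀ c : ι → ℝ, γ x (∑ i, c i • g i x) = c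
  commute : ∀ x ∈ O, ∀ a b, lieBracket ℝ (fun y => T y a) (fun y => T y b) x = 0
  bracket_mem : ∀ i, ∀ x ∈ O, ∀ a, ∃ (b : F) (c : ι → ℝ), lieBracket ℝ (fun y => T y a) (g i) x =
    T x b + ∑ j, c j • g j x

/-- The bracket `a ↦ [T a, h]` of a frame with a field, as a field of linear maps. -/
noncomputable def frameBracket (T : E → F →L[ℝ] E) (h : E → E) (x : E) : F →L[ℝ] E :=
  fderiv ℝ h x ∘L T x - fderiv ℝ T x (h x)

theorem frameBracket_apply {T : E → F →L[ℝ] E} {h : E → E} {x : E} (hT : DifferentiableAt ℝ T x)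
    (a : F) : frameBracket T h x a = lieBracket ℝ (fun y => T y a) h x := by
  have h2 := (hT.hasFDerivAt.clm_apply (hasFDerivAt_const a x)).fderiv
  simp only [lieBracket, h2, frameBracket]
  simp

/-- The right-hand side of the equation `DP (T a) = B (x, P) a` for the feedback `P`: it says that
`[T a, f + ∑ i, P i • g i]` has no component along the `g i`. -/
noncomputable def feedbackRHS (T : E → F →L[ℝ] E) (g : ι → E → E) (γ : E → E →L[ℝ] (ι → ℝ))
    (f : E → E) (q : E × (ι → ℝ)) : F →L[ℝ] (ι → ℝ) :=
  -(γ q.1 ∘L frameBracket T f q.1) - ∑ i, q.2 i • (γ q.1 ∘L frameBracket T (g i) q.1)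

namespace AdaptedFrame

variable {r : WithTop ℕ∞} {O : Set E} {T : E → F →L[ℝ] E} {g : ι → E → E}
  {γ : E → E →L[ℝ] (ι → ℝ)} {ℓ : E →L[ℝ] F} {f : E → E}

theorem contDiffOn_feedbackRHS (hr : r = ∞ ∨ r = ω) (hO : IsOpen O) (H : AdaptedFrame r O T g γ ℓ)
    (hf : ContDiffOn ℝ r f O) : ContDiffOn ℝ r (feedbackRHS T g γ f) (O ×ˢ univ) := by
  have hbr : ∀ h : E → E, ContDiffOn ℝ r h O →
      ContDiffOn ℝ r (fun q : E × (ι → ℝ) => γ q.1 ∘L frameBracket T h q.1) (O ×ˢ univ) := by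
    intro h hh
    have hs := add_one_le_of_eq_infty_or_omega hr
    have h1 : ContDiffOn ℝ r (fun x => γ x ∘L frameBracket T h x) O :=
      H.contDiffOn_coeff.clm_comp (((hh.fderiv_of_isOpen hO hs).clm_comp H.contDiffOn_frame).sub
        ((H.contDiffOn_frame.fderiv_of_isOpen hO hs).clm_apply hh))
    exact h1.comp contDiffOn_fst fun q hq => hq.1
  refine (hbr f hf).neg.sub (ContDiffOn.sum fun i _ => ContDiffOn.fun_smul ?_ (hbr _ ?_))
  · exact ((contDiff_apply ℝ ℝ i).comp contDiff_snd).contDiffOn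
  · exact H.contDiffOn_input i

variable (hr1 : 1 ≤ r) (hO : IsOpen O) (H : AdaptedFrame r O T g γ ℓ)
include hr1 hO H

theorem differentiableAt_frame {x : E} (hx : x ∈ O) : DifferentiableAt ℝ T x :=
  (H.contDiffOn_frame.differentiableOn (zero_lt_one.trans_le hr1).ne' x hx).differentiableAt
    (hO.mem_nhds hx)

theorem differentiableAt_input (i : ι) {x : E} (hx : x ∈ O) : DifferentiableAt ℝ (g i) x :=
  ((H.contDiffOn_input i).differentiableOn (zero_lt_one.trans_le hr1).ne' x hx).differentiableAt
    (hO.mem_nhds hx)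

theorem fderiv_frame_symm {x : E} (hx : x ∈ O) (a b : F) :
    fderiv ℝ T x (T x a) b = fderiv ℝ T x (T x b) a := by
  have hT := H.differentiableAt_frame hr1 hO hx
  have h1 := H.commute x hx a b
  have ha := (hT.hasFDerivAt.clm_apply (hasFDerivAt_const a x)).fderiv
  have hb := (hT.hasFDerivAt.clm_apply (hasFDerivAt_const b x)).fderiv
  simp only [lieBracket, ha, hb] at h1
  simpa [sub_eq_zero] using h1

/-- The bracket of the frame with the fed-back field, and its component along the `g i`. -/
theorem exists_lieBracket_feedback {x : E} (hx : x ∈ O) (hf : DifferentiableAt ℝ f x)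
    (hfT : ∀ a, ∃ (b : F) (c : ι → ℝ), lieBracket ℝ (fun y => T y a) f x = T x b + ∑ j, c j • g j x)
    {P : E → ι → ℝ} (hP : DifferentiableAt ℝ P x) (a : F) :
    ∃ b, lieBracket ℝ (fun y => T y a) (fun y => f y + ∑ i, P y i • g i y) x =
      T x b + ∑ j, (fderiv ℝ P x (T x a) - feedbackRHS T g γ f (x, P x) a) j • g j x := by
  have hT := H.differentiableAt_frame hr1 hO hx
  have hPi : ∀ i, HasFDerivAt (fun y => P y i) (ContinuousLinearMap.proj i ∘L fderiv ℝ P x) x :=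
    fun i => (ContinuousLinearMap.proj (R := ℝ) (φ := fun _ : ι => ℝ) i).hasFDerivAt.comp x
      hP.hasFDerivAt
  have hterm : ∀ i, HasFDerivAt (fun y => P y i • g i y) _ x := fun i =>
    (hPi i).smul (H.differentiableAt_input hr1 hO i hx).hasFDerivAt
  have hall : HasFDerivAt (fun y => f y + ∑ i, P y i • g i y) _ x :=
    hf.hasFDerivAt.add (HasFDerivAt.fun_sum fun i _ => hterm i)
  have hexp : lieBracket ℝ (fun y => T y a) (fun y => f y + ∑ i, P y i • g i y) x =
      frameBracket T f x a + ∑ i, P x i • frameBracket T (g i) x a +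
        ∑ i, fderiv ℝ P x (T x a) i • g i x := by
    rw [← frameBracket_apply hT]
    simp only [frameBracket, hall.fderiv]
    simp [Finset.sum_add_distrib, smul_sub]
    abel
  -- a vector of `range T ⊕ span g` is recovered from its coefficients along `g`
  have hrec : ∀ (w : E) (b : F) (c : ι → ℝ), w = T x b + ∑ j, c j • g j x →
      w = T x b + ∑ j, γ x w j • g j x := by
    intro w b c hw
    have : γ x w = c := by rw [hw, map_add, H.coeff_frame x hx, H.coeff_sum x hx, zero_add]
    rw [this, ← hw]
  have hfa : ∃ b, frameBracket T f x a = T x b + ∑ j, γ x (frameBracket T f x a) j • g j x := by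
    obtain ⟨b, c, h⟩ := hfT a
    rw [← frameBracket_apply hT] at h
    exact ⟨b, hrec _ b c h⟩
  have hga : ∀ i, ∃ b, frameBracket T (g i) x a =
      T x b + ∑ j, γ x (frameBracket T (g i) x a) j • g j x := by
    intro i
    obtain ⟨b, c, h⟩ := H.bracket_mem i x hx a
    rw [← frameBracket_apply hT] at h
    exact ⟨b, hrec _ b c h⟩
  obtain ⟨b, hb⟩ := hfa
  choose b' hb' using hga
  refine ⟨b + ∑ i, P x i • b' i, ?_⟩
  have hsum : ∑ i, P x i • frameBracket T (g i) x a = T x (∑ i, P x i • b' i) +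
      ∑ j, (∑ i, P x i * γ x (frameBracket T (g i) x a) j) • g j x := by
    conv_lhs => enter [2, i]; rw [hb' i]
    simp only [smul_add, Finset.sum_add_distrib, map_sum, map_smul, Finset.smul_sum, smul_smul,
      Finset.sum_smul]
    rw [Finset.sum_comm]
  have hval : ∀ j, feedbackRHS T g γ f (x, P x) a j = -(γ x (frameBracket T f x a) j) -
      ∑ i, P x i * γ x (frameBracket T (g i) x a) j := fun j => by
    simp [feedbackRHS]
  rw [hexp, hsum]
  simp only [Pi.sub_apply, hval, sub_smul, Finset.sum_sub_distrib, map_add, neg_smul,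
    Finset.sum_neg_distrib]
  conv_lhs => enter [1, 1]; rw [hb]
  abel

/-- The integrability condition for the feedback equation. It follows from the Jacobi identity for
`T a`, `T b` and the field obtained by a feedback that satisfies the equation at `x`. -/
theorem fderiv_feedbackRHS_symm (hr : r = ∞ ∨ r = ω) (hf : ContDiffOn ℝ r f O)
    (hfT : ∀ x ∈ O, ∀ a, ∃ (b : F) (c : ι → ℝ),
      lieBracket ℝ (fun y => T y a) f x = T x b + ∑ j, c j • g j x)
    {x : E} (hx : x ∈ O) (P₀ : ι → ℝ) (a b : F) :
    fderiv ℝ (feedbackRHS T g γ f) (x, P₀) (T x a, feedbackRHS T g γ f (x, P₀) a) b =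
      fderiv ℝ (feedbackRHS T g γ f) (x, P₀) (T x b, feedbackRHS T g γ f (x, P₀) b) a := by
  have hr0 : r ≠ 0 := (zero_lt_one.trans_le hr1).ne'
  set B := feedbackRHS T g γ f
  have hB : ContDiffOn ℝ r B (O ×ˢ univ) := contDiffOn_feedbackRHS hr hO H hf
  have hOV : IsOpen (O ×ˢ univ : Set (E × (ι → ℝ))) := hO.prod isOpen_univ
  have hdiff : ∀ {V : Type _} [NormedAddCommGroup V] [NormedSpace ℝ V] {k : E → V},
      ContDiffOn ℝ r k O → DifferentiableAt ℝ k x := fun hk =>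
    (hk.differentiableOn hr0 x hx).differentiableAt (hO.mem_nhds hx)
  -- a feedback satisfying the equation at `x`
  let P : E → ι → ℝ := fun y => P₀ + B (x, P₀) (ℓ (y - x))
  have hPd : ∀ y, HasFDerivAt P (B (x, P₀) ∘L ℓ) y := fun y =>
    (((B (x, P₀) ∘L ℓ).hasFDerivAt.comp y ((hasFDerivAt_id y).sub_const x)).const_add P₀)
  have hPc : ContDiff ℝ r P :=
    contDiff_const.add ((B (x, P₀) ∘L ℓ).contDiff.comp (contDiff_id.sub contDiff_const))
  have hPx : P x = P₀ := by simp [P]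
  let G : E → E := fun y => f y + ∑ i, P y i • g i y
  have hG : ContDiffOn ℝ r G O := hf.add (ContDiffOn.sum fun i _ =>
    ContDiffOn.fun_smul (((contDiff_apply ℝ ℝ i).comp hPc).contDiffOn) (H.contDiffOn_input i))
  have hTc : ∀ a, ContDiffOn ℝ r (fun y => T y a) O := fun a =>
    H.contDiffOn_frame.clm_apply contDiffOn_const
  let w : F → E → E := fun a => lieBracket ℝ (fun y => T y a) G
  have hw : ∀ a, ContDiffOn ℝ r (w a) O := fun a => contDiffOn_lieBracket hr hO (hTc a) hG
  let ρ : F → E → ι → ℝ := fun a y => B (x, P₀) a - B (y, P y) a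
  have hρ : ∀ a, ContDiffOn ℝ r (ρ a) O := fun a =>
    contDiffOn_const.sub ((hB.comp (contDiffOn_id.prodMk hPc.contDiffOn)
      fun y hy => ⟨hy, mem_univ _⟩).clm_apply contDiffOn_const)
  have hρx : ∀ a, ρ a x = 0 := fun a => by simp [ρ, hPx]
  have hρd : ∀ a b, fderiv ℝ (ρ a) x (T x b) = -fderiv ℝ B (x, P₀) (T x b, B (x, P₀) b) a := by
    intro a b
    have h1 : HasFDerivAt B (fderiv ℝ B (x, P₀)) (x, P x) := by
      rw [hPx]
      exact ((hB.differentiableOn hr0 (x, P₀) ⟨hx, mem_univ _⟩).differentiableAt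
        (hOV.mem_nhds ⟨hx, mem_univ _⟩)).hasFDerivAt
    have h2 : HasFDerivAt (ρ a) _ x :=
      ((h1.comp x ((hasFDerivAt_id x).prodMk (hPd x))).clm_apply
        (hasFDerivAt_const a x)).const_sub (B (x, P₀) a)
    rw [h2.fderiv]
    simp [H.left_inv x hx]
  have hwρ : ∀ a, ∀ y ∈ O, ∃ c, w a y = T y c + ∑ j, ρ a y j • g j y := by
    intro a y hy
    obtain ⟨c, hc⟩ := H.exists_lieBracket_feedback hr1 hO hy
      ((hf.differentiableOn hr0 y hy).differentiableAt (hO.mem_nhds hy)) (hfT y hy)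
      (hPd y).differentiableAt a
    refine ⟨c, ?_⟩
    rw [(hPd y).fderiv, ContinuousLinearMap.comp_apply, H.left_inv y hy] at hc
    exact hc
  -- along `g`, the bracket with `T b` differentiates the coefficients `ρ a`, as they vanish at `x`
  have key : ∀ a b, γ x (lieBracket ℝ (fun y => T y b) (w a) x) = fderiv ℝ (ρ a) x (T x b) := by
    intro a b
    -- the coefficients of `w a` along the frame
    let c : E → F := fun y => ℓ (w a y - ∑ j, ρ a y j • g j y)
    have hc : ContDiffOn ℝ r c O := ℓ.contDiff.comp_contDiffOn ((hw a).sub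
      (ContDiffOn.sum fun i _ => ContDiffOn.fun_smul
        ((contDiff_apply ℝ ℝ i).comp_contDiffOn (hρ a)) (H.contDiffOn_input i)))
    have hwc : w a =ᶠ[𝓝 x] fun y => T y (c y) + ∑ j, ρ a y j • g j y := by
      filter_upwards [hO.mem_nhds hx] with y hy
      obtain ⟨c', hc'⟩ := hwρ a y hy
      have : c y = c' := by simp [c, hc', H.left_inv y hy]
      rw [this, hc']
    have hT := H.differentiableAt_frame hr1 hO hx
    have hTcb : ∀ b, lieBracket ℝ (fun y => T y b) (fun y => T y (c y)) x =
        T x (fderiv ℝ c x (T x b)) := fun b => by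
      rw [lieBracket_clm_apply_right hT (hdiff hc), H.commute x hx, zero_add]
    rw [lieBracket_congr_nhds Filter.EventuallyEq.rfl hwc]
    obtain ⟨b', hb'⟩ := H.exists_lieBracket_feedback hr1 hO hx
      (f := fun y => T y (c y)) (hT.clm_apply (hdiff hc))
      (fun b => ⟨_, 0, by rw [hTcb b]; simp; rfl⟩)
      (((hρ a).differentiableOn hr0 x hx).differentiableAt (hO.mem_nhds hx)) b
    have h0 : feedbackRHS T g γ (fun y => T y (c y)) (x, ρ a x) b = 0 := by
      simp [feedbackRHS, hρx, frameBracket_apply hT, hTcb, H.coeff_frame x hx]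
    rw [hb', h0, map_add, H.coeff_frame x hx, H.coeff_sum x hx, zero_add, sub_zero]
  have hat : ∀ {k : E → E}, ContDiffOn ℝ r k O → ContDiffAt ℝ r k x := fun hk =>
    hk.contDiffAt (hO.mem_nhds hx)
  have hmin : minSmoothness ℝ 2 ≤ r := by
    rcases hr with rfl | rfl
    · simpa using WithTop.coe_le_coe.2 (le_top : (2 : ℕ∞) ≤ ⊤)
    · simp
  have jac := leibniz_identity_lieBracket hmin (hat (hTc b)) (hat (hTc a)) (hat hG)
  have h0 : lieBracket ℝ (lieBracket ℝ (fun y => T y b) (fun y => T y a)) G x = 0 := by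
    rw [lieBracket_congr_nhds (V' := 0) (W' := G) ?_ Filter.EventuallyEq.rfl]
    · simp
    · filter_upwards [hO.mem_nhds hx] with y hy using H.commute y hy b a
  rw [h0, zero_add] at jac
  have h1 := key a b
  have h2 := key b a
  rw [show lieBracket ℝ (fun y => T y b) (w a) x = lieBracket ℝ (fun y => T y a) (w b) x from jac,
    h2, hρd, hρd] at h1
  exact neg_injective h1

end AdaptedFrame

end AdaptedFrame

/-! ### Local feedback in a vector space -/

section LocalFeedback

open Set VectorField

/-- A field of endomorphisms that is the identity at `x₀` has an equally regular inverse
near `x₀`. -/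
theorem exists_inverse_field {E G : Type*} [NormedAddCommGroup E] [NormedSpace ℝ E]
    [NormedAddCommGroup G] [NormedSpace ℝ G] [CompleteSpace G] {r : WithTop ℕ∞} {O : Set E}
    (hO : IsOpen O) {x₀ : E} (hx₀ : x₀ ∈ O) {A : E → G →L[ℝ] G} (hA : ContDiffOn ℝ r A O)
    (hA₀ : A x₀ = 1) :
    ∃ (O' : Set E) (N : E → G →L[ℝ] G), IsOpen O' ∧ x₀ ∈ O' ∧ O' ⊆ O ∧ ContDiffOn ℝ r N O' ∧
      (∀ x ∈ O', ∀ v, N x (A x v) = v) ∧ ∀ x ∈ O', ∀ v, A x (N x v) = v := by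
  refine ⟨O ∩ A ⁻¹' {u | IsUnit u}, fun x => Ring.inverse (A x),
    hA.continuousOn.isOpen_inter_preimage hO Units.isOpen, ⟨hx₀, by simp [hA₀]⟩,
    inter_subset_left, ?_, ?_, ?_⟩
  · rintro x ⟨hx, u, hu⟩
    have h1 : ContDiffAt ℝ r Ring.inverse (A x) := hu ▸ contDiffAt_ringInverse ℝ u
    exact (h1.comp_contDiffWithinAt x (hA x hx)).mono inter_subset_left
  · rintro x ⟨-, hx⟩ v
    exact DFunLike.congr_fun (Ring.inverse_mul_cancel _ hx) v
  · rintro x ⟨-, hx⟩ v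
    exact DFunLike.congr_fun (Ring.mul_inverse_cancel _ hx) v

theorem exists_continuous_leftInverse {E G : Type*} [NormedAddCommGroup E] [NormedSpace ℝ E]
    [FiniteDimensional ℝ E] [NormedAddCommGroup G] [NormedSpace ℝ G]
    (K : G →L[ℝ] E) (hK : Function.Injective K) : ∃ L : E →L[ℝ] G, ∀ v, L (K v) = v := by
  obtain ⟨L, hL⟩ := (K : G →ₗ[ℝ] E).exists_leftInverse_of_injective (LinearMap.ker_eq_bot.2 hK)
  exact ⟨L.toContinuousLinearMap, fun v => DFunLike.congr_fun hL v⟩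

variable {E F ι : Type*} [NormedAddCommGroup E] [NormedSpace ℝ E] [FiniteDimensional ℝ E]
  [NormedAddCommGroup F] [NormedSpace ℝ F] [FiniteDimensional ℝ F] [Fintype ι]

/-- The linear map `c ↦ ∑ i, c i • g i x`. -/
noncomputable def frameOf {V : Type*} [NormedAddCommGroup V] [NormedSpace ℝ V] (g : ι → E → V)
    (x : E) : (ι → ℝ) →L[ℝ] V :=
  ∑ i, (ContinuousLinearMap.proj i : (ι → ℝ) →L[ℝ] ℝ).smulRight (g i x)

variable {V : Type*} [NormedAddCommGroup V] [NormedSpace ℝ V]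

omit [FiniteDimensional ℝ E] [NormedAddCommGroup E] [NormedSpace ℝ E] in
@[simp] theorem frameOf_apply (g : ι → E → V) (x : E) (c : ι → ℝ) :
    frameOf g x c = ∑ i, c i • g i x := by
  simp [frameOf]

omit [FiniteDimensional ℝ E] in
theorem contDiffOn_frameOf {r : WithTop ℕ∞} {O : Set E} {g : ι → E → V}
    (hg : ∀ i, ContDiffOn ℝ r (g i) O) : ContDiffOn ℝ r (frameOf g) O :=
  ContDiffOn.sum fun i _ => contDiffOn_const.smulRight (hg i)

/-- The linear map `(a, c) ↦ X x a + ∑ i, c i • g i x`. -/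
noncomputable def sumFrame (X : E → F →L[ℝ] E) (g : ι → E → E) (x : E) : F × (ι → ℝ) →L[ℝ] E :=
  (X x).coprod (frameOf g x)

omit [FiniteDimensional ℝ E] [FiniteDimensional ℝ F] in
@[simp] theorem sumFrame_apply (X : E → F →L[ℝ] E) (g : ι → E → E) (x : E) (q : F × (ι → ℝ)) :
    sumFrame X g x q = X x q.1 + ∑ i, q.2 i • g i x := by
  simp [sumFrame]

omit [FiniteDimensional ℝ E] [FiniteDimensional ℝ F] in
theorem contDiffOn_sumFrame {r : WithTop ℕ∞} {O : Set E} {X : E → F →L[ℝ] E} {g : ι → E → E}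
    (hX : ContDiffOn ℝ r X O) (hg : ∀ i, ContDiffOn ℝ r (g i) O) :
    ContDiffOn ℝ r (sumFrame X g) O := by
  have h : sumFrame X g = fun x => X x ∘L ContinuousLinearMap.fst ℝ F (ι → ℝ) +
      frameOf g x ∘L ContinuousLinearMap.snd ℝ F (ι → ℝ) := by
    ext x q <;> simp [sumFrame]
  rw [h]
  exact (hX.clm_comp contDiffOn_const).add ((contDiffOn_frameOf hg).clm_comp contDiffOn_const)

/-- A frame can be normalized to a commuting one: if `ℓ` is a left inverse of `X x₀`, the fields
`X x (ℓ ∘ X x)⁻¹ a` are mapped by `ℓ` to constants, so that `ℓ` kills their brackets. -/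
theorem exists_adaptedFrame {r : WithTop ℕ∞} (hr : r = ∞ ∨ r = ω) {O : Set E} (hO : IsOpen O)
    {x₀ : E} (hx₀ : x₀ ∈ O) {X : E → F →L[ℝ] E} (hX : ContDiffOn ℝ r X O) {g : ι → E → E}
    (hg : ∀ i, ContDiffOn ℝ r (g i) O) (hinj : Function.Injective (sumFrame X g x₀))
    (hXX : ∀ x ∈ O, ∀ a b, lieBracket ℝ (fun y => X y a) (fun y => X y b) x ∈
      LinearMap.range (X x : F →ₗ[ℝ] E))
    (hXg : ∀ i, ∀ x ∈ O, ∀ a, ∃ (b : F) (c : ι → ℝ),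
      lieBracket ℝ (fun y => X y a) (g i) x = X x b + ∑ j, c j • g j x) :
    ∃ (O' : Set E) (M : E → F →L[ℝ] F) (γ : E → E →L[ℝ] (ι → ℝ)) (ℓ : E →L[ℝ] F),
      IsOpen O' ∧ x₀ ∈ O' ∧ O' ⊆ O ∧ ContDiffOn ℝ r M O' ∧
      (∀ x ∈ O', ∀ a, M x (ℓ (X x a)) = a) ∧
      AdaptedFrame r O' (fun x => X x ∘L M x) g γ ℓ := by
  have hr1 := one_le_of_eq_infty_or_omega hr
  have hr0 : r ≠ 0 := (zero_lt_one.trans_le hr1).ne'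
  have hK := contDiffOn_sumFrame hX hg
  obtain ⟨L, hL⟩ := exists_continuous_leftInverse _ hinj
  obtain ⟨O₁, N, hO₁, hx₁, hO₁O, hN, hNK, -⟩ := exists_inverse_field hO hx₀
    (contDiffOn_const.clm_comp hK : ContDiffOn ℝ r (fun x => L ∘L sumFrame X g x) O)
    (ContinuousLinearMap.ext hL)
  let ℓ : E →L[ℝ] F := ContinuousLinearMap.fst ℝ F (ι → ℝ) ∘L L
  obtain ⟨O₂, M, hO₂, hx₂, hO₂O, hM, hMX, hXM⟩ := exists_inverse_field hO hx₀
    (contDiffOn_const.clm_comp hX : ContDiffOn ℝ r (fun x => ℓ ∘L X x) O)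
    (by
      ext a
      have := hL (a, 0)
      simp only [sumFrame_apply, Pi.zero_apply, zero_smul, Finset.sum_const_zero, add_zero] at this
      simp [ℓ, this])
  have hM' := hM.mono (inter_subset_right : O₁ ∩ O₂ ⊆ O₂)
  have hO' := hO₁.inter hO₂
  have hTc : ContDiffOn ℝ r (fun x => X x ∘L M x) (O₁ ∩ O₂) :=
    (hX.mono (inter_subset_left.trans hO₁O)).clm_comp hM'
  have hXd : ∀ x ∈ O₁ ∩ O₂, DifferentiableAt ℝ X x := fun x hx =>
    (hX.differentiableOn hr0 x (hO₁O hx.1)).differentiableAt (hO.mem_nhds (hO₁O hx.1))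
  have hMd : ∀ x ∈ O₁ ∩ O₂, ∀ a, DifferentiableAt ℝ (fun y => M y a) x := fun x hx a =>
    ((hM'.differentiableOn hr0 x hx).differentiableAt (hO'.mem_nhds hx)).clm_apply
      (differentiableAt_const a)
  have hTd : ∀ x ∈ O₁ ∩ O₂, ∀ a, DifferentiableAt ℝ (fun y => X y (M y a)) x := fun x hx a =>
    (hXd x hx).clm_apply (hMd x hx a)
  have hℓT : ∀ x ∈ O₁ ∩ O₂, ∀ a, ℓ (X x (M x a)) = a := fun x hx a => hXM x hx.2 a
  refine ⟨O₁ ∩ O₂, M, fun x => ContinuousLinearMap.snd ℝ F (ι → ℝ) ∘L N x ∘L L, ℓ, hO',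
    ⟨hx₁, hx₂⟩, inter_subset_left.trans hO₁O, hM', fun x hx a => hMX x hx.2 a, hTc,
    fun i => (hg i).mono (inter_subset_left.trans hO₁O),
    contDiffOn_const.clm_comp ((hN.mono inter_subset_left).clm_comp contDiffOn_const),
    hℓT, ?_, ?_, ?_, ?_⟩
  · intro x hx a
    have h := hNK x hx.1 (M x a, 0)
    simp only [ContinuousLinearMap.comp_apply, sumFrame_apply, Pi.zero_apply, zero_smul,
      Finset.sum_const_zero, add_zero] at h
    simp [h]
  · intro x hx c
    have h := hNK x hx.1 (0, c)
    simp only [ContinuousLinearMap.comp_apply, sumFrame_apply, map_zero, zero_add] at h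
    simp only [ContinuousLinearMap.comp_apply, h, ContinuousLinearMap.coe_snd']
  · intro x hx a b
    simp only [ContinuousLinearMap.comp_apply]
    have hmem : lieBracket ℝ (fun y => X y (M y a)) (fun y => X y (M y b)) x ∈
        LinearMap.range (X x : F →ₗ[ℝ] E) := by
      rw [lieBracket_clm_apply_right (hXd x hx) (hMd x hx b),
        lieBracket_clm_apply_left (hXd x hx) (hMd x hx a)]
      exact add_mem (sub_mem (hXX x (hO₁O hx.1) _ _) ⟨_, rfl⟩) ⟨_, rfl⟩
    obtain ⟨c, hc⟩ := hmem
    -- `ℓ` maps the fields `T b` to constants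
    have hzero : ∀ b v, ℓ (fderiv ℝ (fun y => X y (M y b)) x v) = 0 := by
      intro b v
      have h1 := (ℓ.hasFDerivAt.comp x (hTd x hx b).hasFDerivAt)
      have h2 : HasFDerivAt (ℓ ∘ fun y => X y (M y b)) (0 : E →L[ℝ] F) x := by
        refine (hasFDerivAt_const b x).congr_of_eventuallyEq ?_
        filter_upwards [hO'.mem_nhds hx] with y hy using hℓT y hy b
      exact DFunLike.congr_fun (h1.unique h2) v
    have hℓ0 : ℓ (X x c) = 0 := by
      have : X x c = _ := hc
      rw [this]
      simp [lieBracket, hzero]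
    have hc0 : c = 0 := by
      rw [← hMX x hx.2 c]
      simp only [ContinuousLinearMap.comp_apply, hℓ0, map_zero]
    rw [← hc, hc0]
    simp
  · intro i x hx a
    obtain ⟨b, c, h⟩ := hXg i x (hO₁O hx.1) (M x a)
    have hX' : ∀ v, X x v = X x (M x (ℓ (X x v))) := fun v => by
      rw [show M x (ℓ (X x v)) = v from hMX x hx.2 v]
    refine ⟨ℓ (X x b) - ℓ (X x (fderiv ℝ (fun y => M y a) x (g i x))), c, ?_⟩
    simp only [ContinuousLinearMap.comp_apply, map_sub]
    rw [lieBracket_clm_apply_left (hXd x hx) (hMd x hx a), h, ← hX', ← hX']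
    abel

end LocalFeedback

/-- Existence of the feedback for one field `f`: near `x₀` there are functions `α i` such that
`f + ∑ i, α i • g i` preserves the distribution spanned by the frame `X`. -/
theorem exists_feedback.{u} {E : Type u} {F ι : Type} [NormedAddCommGroup E] [NormedSpace ℝ E]
    [FiniteDimensional ℝ E] [NormedAddCommGroup F] [NormedSpace ℝ F] [FiniteDimensional ℝ F]
    [Fintype ι] {r : WithTop ℕ∞} (hr : r = ∞ ∨ r = ω) {O : Set E} (hO : IsOpen O)
    {x₀ : E} (hx₀ : x₀ ∈ O) {X : E → F →L[ℝ] E} (hX : ContDiffOn ℝ r X O) {g : ι → E → E}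
    (hg : ∀ i, ContDiffOn ℝ r (g i) O) (hinj : Function.Injective (sumFrame X g x₀))
    (hXX : ∀ x ∈ O, ∀ a b, VectorField.lieBracket ℝ (fun y => X y a) (fun y => X y b) x ∈
      LinearMap.range (X x : F →ₗ[ℝ] E))
    (hXg : ∀ i, ∀ x ∈ O, ∀ a, ∃ (b : F) (c : ι → ℝ),
      VectorField.lieBracket ℝ (fun y => X y a) (g i) x = X x b + ∑ j, c j • g j x)
    {f : E → E} (hf : ContDiffOn ℝ r f O)
    (hXf : ∀ x ∈ O, ∀ a, ∃ (b : F) (c : ι → ℝ),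
      VectorField.lieBracket ℝ (fun y => X y a) f x = X x b + ∑ j, c j • g j x) :
    ∃ (O' : Set E) (α : E → ι → ℝ), IsOpen O' ∧ x₀ ∈ O' ∧ O' ⊆ O ∧ ContDiffOn ℝ r α O' ∧
      α x₀ = 0 ∧ ∀ x ∈ O', ∀ a, VectorField.lieBracket ℝ (fun y => X y a)
        (fun y => f y + ∑ i, α y i • g i y) x ∈ LinearMap.range (X x : F →ₗ[ℝ] E) := by
  have hr1 := one_le_of_eq_infty_or_omega hr
  have hr0 : r ≠ 0 := (zero_lt_one.trans_le hr1).ne'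
  obtain ⟨O₁, M, γ, ℓ, hO₁, hx₁, hO₁O, hM, hMX, H⟩ :=
    exists_adaptedFrame hr hO hx₀ hX hg hinj hXX hXg
  have hXd : ∀ x ∈ O₁, DifferentiableAt ℝ X x := fun x hx =>
    (hX.differentiableOn hr0 x (hO₁O hx)).differentiableAt (hO.mem_nhds (hO₁O hx))
  have hf₁ := hf.mono hO₁O
  have hTf : ∀ x ∈ O₁, ∀ a, ∃ (b : F) (c : ι → ℝ),
      VectorField.lieBracket ℝ (fun y => (X y ∘L M y) a) f x =
        (X x ∘L M x) b + ∑ j, c j • g j x := by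
    intro x hx a
    obtain ⟨b, c, h⟩ := hXf x (hO₁O hx) (M x a)
    refine ⟨ℓ (X x b) - ℓ (X x (fderiv ℝ (fun y => M y a) x (f x))), c, ?_⟩
    have hMd : DifferentiableAt ℝ (fun y => M y a) x :=
      ((hM.differentiableOn hr0 x hx).differentiableAt (hO₁.mem_nhds hx)).clm_apply
        (differentiableAt_const a)
    simp only [ContinuousLinearMap.comp_apply, map_sub]
    rw [lieBracket_clm_apply_left (hXd x hx) hMd, h, hMX x hx, hMX x hx]
    abel
  obtain ⟨O₂, P, hO₂, hx₂, hO₂O, hP, hP₀, hPd⟩ := exists_solution_along_frame hr hO₁ hx₁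
    H.contDiffOn_frame (AdaptedFrame.contDiffOn_feedbackRHS hr hO₁ H hf₁)
    (fun x hx a b => H.fderiv_frame_symm hr1 hO₁ hx a b)
    (fun x hx P a b => H.fderiv_feedbackRHS_symm hr1 hO₁ hr hf₁ hTf hx P a b)
    (H.left_inv x₀ hx₁) 0
  refine ⟨O₂, P, hO₂, hx₂, hO₂O.trans hO₁O, hP, hP₀, fun x hx a => ?_⟩
  have hxO := hO₂O hx
  have hT := H.differentiableAt_frame hr1 hO₁ hxO
  have hℓX : DifferentiableAt ℝ (fun y => ℓ (X y a)) x :=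
    ℓ.differentiableAt.comp x ((hXd x hxO).clm_apply (differentiableAt_const a))
  have hloc : (fun y => X y a) =ᶠ[𝓝 x] fun y => (X y ∘L M y) (ℓ (X y a)) := by
    filter_upwards [hO₁.mem_nhds hxO] with y hy
    rw [ContinuousLinearMap.comp_apply, hMX y hy]
  rw [lieBracket_congr_nhds hloc Filter.EventuallyEq.rfl, lieBracket_clm_apply_left hT hℓX]
  obtain ⟨b, hb⟩ := H.exists_lieBracket_feedback hr1 hO₁ hxO
    ((hf₁.differentiableOn hr0 x hxO).differentiableAt (hO₁.mem_nhds hxO)) (hTf x hxO)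
    ((hP.differentiableOn hr0 x hx).differentiableAt (hO₂.mem_nhds hx)) (ℓ (X x a))
  rw [hb, hPd x hx]
  refine sub_mem ⟨M x b, ?_⟩ ⟨_, rfl⟩
  simp

/-! ### Local frames of distributions of constant rank -/

section Frames

open Set VectorField

/-- Independent fields that span a family of subspaces at one point do so nearby, provided they are
sections of the family and its dimension is constant. -/
theorem exists_injective_range_eq {E G : Type*} [NormedAddCommGroup E] [NormedSpace ℝ E]
    [FiniteDimensional ℝ E] [NormedAddCommGroup G] [NormedSpace ℝ G] [FiniteDimensional ℝ G]
    {r : WithTop ℕ∞} {O : Set E} (hO : IsOpen O) {x₀ : E} (hx₀ : x₀ ∈ O)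
    {K : E → G →L[ℝ] E} (hK : ContDiffOn ℝ r K O) {R : E → Submodule ℝ E}
    (hKR : ∀ x ∈ O, LinearMap.range (K x : G →ₗ[ℝ] E) ≤ R x)
    (hR : ∀ x ∈ O, Module.finrank ℝ (R x) = Module.finrank ℝ (R x₀))
    (hinj : Function.Injective (K x₀)) (hspan : R x₀ ≤ LinearMap.range (K x₀ : G →ₗ[ℝ] E)) :
    ∃ O' : Set E, IsOpen O' ∧ x₀ ∈ O' ∧ O' ⊆ O ∧
      ∀ x ∈ O', Function.Injective (K x) ∧ R x = LinearMap.range (K x : G →ₗ[ℝ] E) := by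
  obtain ⟨L, hL⟩ := exists_continuous_leftInverse _ hinj
  obtain ⟨O', N, hO', hx', hO'O, -, hN, -⟩ := exists_inverse_field hO hx₀
    (contDiffOn_const.clm_comp hK : ContDiffOn ℝ r (fun x => L ∘L K x) O)
    (ContinuousLinearMap.ext hL)
  refine ⟨O', hO', hx', hO'O, fun x hx => ?_⟩
  have hi : ∀ x ∈ O', Function.Injective (K x) := fun x hx v w hvw => by
    rw [← hN x hx v, ← hN x hx w]
    simp only [ContinuousLinearMap.comp_apply, hvw]
  have hfin : ∀ x ∈ O', Module.finrank ℝ (LinearMap.range (K x : G →ₗ[ℝ] E)) =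
      Module.finrank ℝ G := fun x hx => LinearMap.finrank_range_of_inj (hi x hx)
  refine ⟨hi x hx, (Submodule.eq_of_le_of_finrank_eq (hKR x (hO'O hx)) ?_).symm⟩
  rw [hfin x hx, hR x (hO'O hx), le_antisymm hspan (hKR x₀ hx₀), hfin x₀ hx']

variable {E : Type*} [NormedAddCommGroup E] [NormedSpace ℝ E] [FiniteDimensional ℝ E]

/-- A distribution of constant rank spanned by `C^r` fields has a `C^r` frame near each point:
fields forming a basis at `x₀` stay independent nearby, and then span for reasons of dimension. -/
theorem exists_frame {r : WithTop ℕ∞} {O : Set E} (hO : IsOpen O) {x₀ : E} (hx₀ : x₀ ∈ O)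
    {D : E → Submodule ℝ E} {S : Set (E → E)} (hS : ∀ V ∈ S, ContDiffOn ℝ r V O)
    (hDS : ∀ x ∈ O, D x = Submodule.span ℝ ((fun V : E → E => V x) '' S))
    (hD : ∀ x ∈ O, Module.finrank ℝ (D x) = Module.finrank ℝ (D x₀)) :
    ∃ (O' : Set E) (d : ℕ) (X : E → (Fin d → ℝ) →L[ℝ] E), IsOpen O' ∧ x₀ ∈ O' ∧ O' ⊆ O ∧
      ContDiffOn ℝ r X O' ∧ ∀ x ∈ O', Function.Injective (X x) ∧
        D x = LinearMap.range (X x : (Fin d → ℝ) →ₗ[ℝ] E) := by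
  obtain ⟨κ, a, -, hspan, hind⟩ := exists_linearIndependent' ℝ (fun V : S => (V : E → E) x₀)
  have : Finite κ := hind.finite
  obtain ⟨d, ⟨σ⟩⟩ := Finite.exists_equiv_fin κ
  let V : Fin d → E → E := fun i => a (σ.symm i)
  have hVS : ∀ i, V i ∈ S := fun i => (a (σ.symm i)).2
  have hX : ContDiffOn ℝ r (frameOf V) O := contDiffOn_frameOf fun i => hS _ (hVS i)
  have hindV : LinearIndependent ℝ fun i => V i x₀ := hind.comp _ σ.symm.injective
  have hinj : Function.Injective (frameOf V x₀) := by
    rw [injective_iff_map_eq_zero]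
    intro c h
    rw [frameOf_apply] at h
    exact funext (Fintype.linearIndependent_iff.1 hindV c h)
  have hrange : ∀ x, LinearMap.range (frameOf V x : (Fin d → ℝ) →ₗ[ℝ] E) =
      Submodule.span ℝ (range fun i => V i x) := fun x => by
    rw [← Fintype.range_linearCombination ℝ]
    congr 1
    ext c
    simp [Fintype.linearCombination_apply]
  obtain ⟨O', h1, h2, h3, h4⟩ := exists_injective_range_eq hO hx₀ hX (R := D)
    (fun x hx => by
      rw [hrange, hDS x hx]
      refine Submodule.span_mono ?_
      rintro _ ⟨i, rfl⟩
      exact ⟨V i, hVS i, rfl⟩) hD hinj (by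
      rw [hrange, hDS x₀ hx₀, image_eq_range, ← hspan]
      refine Submodule.span_mono ?_
      rintro _ ⟨k, rfl⟩
      exact ⟨σ k, by simp [V]⟩)
  exact ⟨O', d, frameOf V, h1, h2, h3, hX.mono h3, h4⟩

/-- If the brackets of a field `h` with a frame of `D` lie in `D`, so do its brackets with all
sections of `D`. -/
theorem lieBracket_mem_of_frame {F : Type*} [NormedAddCommGroup F] [NormedSpace ℝ F]
    [FiniteDimensional ℝ F] {O : Set E} (hO : IsOpen O) {X : E → F →L[ℝ] E}
    (hX : ContDiffOn ℝ 1 X O) (hinj : ∀ x ∈ O, Function.Injective (X x)) {D : E → Submodule ℝ E}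
    (hD : ∀ x ∈ O, D x = LinearMap.range (X x : F →ₗ[ℝ] E)) {h : E → E} {x : E} (hx : x ∈ O)
    (hh : ∀ a, lieBracket ℝ (fun y => X y a) h x ∈ D x) {Z : E → E} (hZ : ContDiffOn ℝ 1 Z O)
    (hZD : ∀ y ∈ O, Z y ∈ D y) : lieBracket ℝ h Z x ∈ D x := by
  obtain ⟨L, hL⟩ := exists_continuous_leftInverse _ (hinj x hx)
  obtain ⟨O', N, hO', hx', hO'O, hN, hNX, -⟩ := exists_inverse_field hO hx
    (contDiffOn_const.clm_comp hX : ContDiffOn ℝ 1 (fun x => L ∘L X x) O)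
    (ContinuousLinearMap.ext hL)
  have hc : ContDiffOn ℝ 1 (fun y => N y (L (Z y))) O' :=
    hN.clm_apply (L.contDiff.comp_contDiffOn (hZ.mono hO'O))
  have hZc : Z =ᶠ[𝓝 x] fun y => X y (N y (L (Z y))) := by
    filter_upwards [hO'.mem_nhds hx'] with y hy
    have h1 := hZD y (hO'O hy)
    rw [hD y (hO'O hy)] at h1
    obtain ⟨c, hc⟩ := h1
    rw [← hc]
    exact congrArg (X y) (hNX y hy c).symm
  rw [lieBracket_congr_nhds Filter.EventuallyEq.rfl hZc, lieBracket_clm_apply_right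
    ((hX.differentiableOn one_ne_zero x hx).differentiableAt (hO.mem_nhds hx))
    ((hc.differentiableOn one_ne_zero x hx').differentiableAt (hO'.mem_nhds hx'))]
  refine add_mem ?_ (by rw [hD x hx]; exact ⟨_, rfl⟩)
  rw [lieBracket_swap]
  exact neg_mem (hh _)

end Frames

/-- The feedback for one field `f`, in terms of all the input fields `g i`. Only those of a
subfamily that is a basis of `(G + D) / D` at `x₀` receive nonzero coefficients. -/
theorem exists_feedback_of_finrank_eq.{u} {E : Type u} {F : Type} [NormedAddCommGroup E]
    [NormedSpace ℝ E] [FiniteDimensional ℝ E] [NormedAddCommGroup F] [NormedSpace ℝ F]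
    [FiniteDimensional ℝ F] {m : ℕ} {r : WithTop ℕ∞} (hr : r = ∞ ∨ r = ω)
    {O : Set E} (hO : IsOpen O) {x₀ : E} (hx₀ : x₀ ∈ O) {X : E → F →L[ℝ] E}
    (hX : ContDiffOn ℝ r X O) (hXinj : ∀ x ∈ O, Function.Injective (X x))
    {D : E → Submodule ℝ E} (hD : ∀ x ∈ O, D x = LinearMap.range (X x : F →ₗ[ℝ] E))
    {g : Fin m → E → E} (hg : ∀ i, ContDiffOn ℝ r (g i) O)
    (hrank : ∀ x ∈ O, Module.finrank ℝ ↥(Submodule.span ℝ (Set.range fun i => g i x) ⊔ D x) =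
      Module.finrank ℝ ↥(Submodule.span ℝ (Set.range fun i => g i x₀) ⊔ D x₀))
    (hXX : ∀ x ∈ O, ∀ a b, VectorField.lieBracket ℝ (fun y => X y a) (fun y => X y b) x ∈ D x)
    (hXg : ∀ i, ∀ x ∈ O, ∀ a, VectorField.lieBracket ℝ (fun y => X y a) (g i) x ∈
      Submodule.span ℝ (Set.range fun i => g i x) ⊔ D x)
    {f : E → E} (hf : ContDiffOn ℝ r f O)
    (hXf : ∀ x ∈ O, ∀ a, VectorField.lieBracket ℝ (fun y => X y a) f x ∈
      Submodule.span ℝ (Set.range fun i => g i x) ⊔ D x) :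
    ∃ (O' : Set E) (α : E → Fin m → ℝ), IsOpen O' ∧ x₀ ∈ O' ∧ O' ⊆ O ∧ ContDiffOn ℝ r α O' ∧
      α x₀ = 0 ∧ ∀ x ∈ O', ∀ a, VectorField.lieBracket ℝ (fun y => X y a)
        (fun y => f y + ∑ i, α y i • g i y) x ∈ D x := by
  classical
  obtain ⟨κ, a, ha, hspan, hind⟩ :=
    exists_linearIndependent' ℝ (fun i => (D x₀).mkQ (g i x₀))
  have : Finite κ := Finite.of_injective a ha
  have := Fintype.ofFinite κ
  have hga : ∀ k, ContDiffOn ℝ r (g (a k)) O := fun k => hg _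
  have hmemD : ∀ x ∈ O, ∀ v, X x v ∈ D x := fun x hx v => by rw [hD x hx]; exact ⟨v, rfl⟩
  have hinj : Function.Injective (sumFrame X (fun k => g (a k)) x₀) := by
    rw [injective_iff_map_eq_zero]
    rintro ⟨v, c⟩ h
    rw [sumFrame_apply] at h
    have h1 := congrArg (D x₀).mkQ h
    have h2 : (D x₀).mkQ (X x₀ v) = 0 := (Submodule.Quotient.mk_eq_zero _).2 (hmemD x₀ hx₀ v)
    rw [map_add, map_zero, h2, zero_add, map_sum] at h1
    simp only [map_smul] at h1
    have hc : c = 0 := funext (Fintype.linearIndependent_iff.1 hind c h1)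
    subst hc
    have hv : X x₀ v = 0 := by simpa using h
    rw [(map_eq_zero_iff _ (hXinj x₀ hx₀)).1 hv]
    rfl
  have hle : ∀ x ∈ O, LinearMap.range (sumFrame X (fun k => g (a k)) x : F × (κ → ℝ) →ₗ[ℝ] E) ≤
      Submodule.span ℝ (Set.range fun i => g i x) ⊔ D x := by
    rintro x hx _ ⟨q, rfl⟩
    rw [ContinuousLinearMap.coe_coe, sumFrame_apply]
    refine add_mem (Submodule.mem_sup_right (hmemD x hx _)) (Submodule.mem_sup_left ?_)
    exact sum_mem fun k _ => Submodule.smul_mem _ _ (Submodule.subset_span ⟨a k, rfl⟩)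
  have hge : Submodule.span ℝ (Set.range fun i => g i x₀) ⊔ D x₀ ≤
      LinearMap.range (sumFrame X (fun k => g (a k)) x₀ : F × (κ → ℝ) →ₗ[ℝ] E) := by
    have hDle : D x₀ ≤
        LinearMap.range (sumFrame X (fun k => g (a k)) x₀ : F × (κ → ℝ) →ₗ[ℝ] E) := by
      rw [hD x₀ hx₀]
      rintro _ ⟨v, rfl⟩
      exact ⟨(v, 0), by simp⟩
    refine sup_le (Submodule.span_le.2 ?_) hDle
    rintro _ ⟨i, rfl⟩
    have h1 : (D x₀).mkQ (g i x₀) ∈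
        Submodule.span ℝ (Set.range ((fun i => (D x₀).mkQ (g i x₀)) ∘ a)) := by
      rw [hspan]; exact Submodule.subset_span ⟨i, rfl⟩
    obtain ⟨c, hc⟩ := (Submodule.mem_span_range_iff_exists_fun ℝ).1 h1
    have h2 : g i x₀ - ∑ k, c k • g (a k) x₀ ∈ D x₀ := by
      rw [← Submodule.Quotient.mk_eq_zero, ← Submodule.mkQ_apply, map_sub, ← hc]
      simp
    have h3 := add_mem (hDle h2) (⟨(0, c), rfl⟩ : sumFrame X (fun k => g (a k)) x₀ (0, c) ∈
      LinearMap.range (sumFrame X (fun k => g (a k)) x₀ : F × (κ → ℝ) →ₗ[ℝ] E))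
    simpa using h3
  obtain ⟨O₁, hO₁, hx₁, hO₁O, hK⟩ := exists_injective_range_eq hO hx₀ (contDiffOn_sumFrame hX hga)
    (R := fun x => Submodule.span ℝ (Set.range fun i => g i x) ⊔ D x) hle hrank hinj hge
  have hconv : ∀ x ∈ O₁, ∀ w ∈ Submodule.span ℝ (Set.range fun i => g i x) ⊔ D x,
      ∃ (b : F) (c : κ → ℝ), w = X x b + ∑ k, c k • g (a k) x := by
    intro x hx w hw
    rw [(hK x hx).2] at hw
    obtain ⟨q, rfl⟩ := hw
    exact ⟨q.1, q.2, sumFrame_apply _ _ _ _⟩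
  obtain ⟨O', P, hO', hx', hO'O, hP, hP₀, hPD⟩ := exists_feedback hr hO₁ hx₁ (hX.mono hO₁O)
    (g := fun k => g (a k)) (fun k => (hga k).mono hO₁O) hinj
    (fun x hx v w => hD x (hO₁O hx) ▸ hXX x (hO₁O hx) v w)
    (fun k x hx v => hconv x hx _ (hXg _ x (hO₁O hx) v)) (hf.mono hO₁O)
    (fun x hx v => hconv x hx _ (hXf x (hO₁O hx) v))
  have hsum : ∀ y, ∑ i, (∑ k, if a k = i then P y k else 0) • g i y = ∑ k, P y k • g (a k) y := by
    intro y
    simp only [Finset.sum_smul, ite_smul, zero_smul]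
    rw [Finset.sum_comm]
    simp
  refine ⟨O', fun x i => ∑ k, if a k = i then P x k else 0, hO', hx', hO'O.trans hO₁O, ?_, ?_, ?_⟩
  · refine contDiffOn_pi.2 fun i => ContDiffOn.sum fun k _ => ?_
    split_ifs
    · exact (contDiff_apply ℝ ℝ k).comp_contDiffOn hP
    · exact contDiffOn_const
  · ext i
    simp [hP₀]
  · intro x hx v
    rw [hD x (hO₁O (hO'O hx))]
    simpa only [hsum] using hPD x hx v

/-! ### Vector fields and distributions in a chart -/

section Chart

open Set VectorField

variable {E : Type*} [NormedAddCommGroup E] [NormedSpace ℝ E]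
  {M : Type*} [TopologicalSpace M] [ChartedSpace E M]

/-- The derivative at `x` of the inverse of the preferred chart at `p`. -/
noncomputable def chartSymmDeriv (p : M) (x : E) :
    E →L[ℝ] TangentSpace 𝓘(ℝ, E) ((extChartAt 𝓘(ℝ, E) p).symm x) :=
  mfderiv 𝓘(ℝ, E) 𝓘(ℝ, E) (extChartAt 𝓘(ℝ, E) p).symm x

/-- The expression of the vector field `X` in the preferred chart at `p`. -/
noncomputable def chartField (p : M) (X : VField E M) : E → E :=
  mpullback 𝓘(ℝ, E) 𝓘(ℝ, E) (extChartAt 𝓘(ℝ, E) p).symm X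

/-- The vector field on the chart domain at `p` whose expression in the chart is `Z`. -/
noncomputable def chartLift (p : M) (Z : E → E) : VField E M :=
  mpullback 𝓘(ℝ, E) 𝓘(ℝ, E) (extChartAt 𝓘(ℝ, E) p) (fun x => (Z x : TangentSpace 𝓘(ℝ, E) x))

/-- The expression of the distribution `D` in the preferred chart at `p`. -/
noncomputable def chartDistribution (p : M) (D : GenDistribution E M) (x : E) : Submodule ℝ E :=
  (D ((extChartAt 𝓘(ℝ, E) p).symm x)).comap
    (chartSymmDeriv p x : E →ₗ[ℝ] TangentSpace 𝓘(ℝ, E) ((extChartAt 𝓘(ℝ, E) p).symm x))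

/-- The image in the chart at `p` of a subset of the manifold. -/
def chartImage (E : Type*) [NormedAddCommGroup E] [NormedSpace ℝ E]
    {M : Type*} [TopologicalSpace M] [ChartedSpace E M] (p : M) (U : Set M) : Set E :=
  (extChartAt 𝓘(ℝ, E) p).target ∩ (extChartAt 𝓘(ℝ, E) p).symm ⁻¹' U

variable {p : M} {U : Set M}

theorem isOpen_chartImage (hU : IsOpen U) : IsOpen (chartImage E p U) :=
  (continuousOn_extChartAt_symm p).isOpen_inter_preimage (isOpen_extChartAt_target p) hU

theorem mem_chartImage {q : M} (hq : q ∈ (extChartAt 𝓘(ℝ, E) p).source) (hqU : q ∈ U) :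
    extChartAt 𝓘(ℝ, E) p q ∈ chartImage E p U :=
  ⟨(extChartAt 𝓘(ℝ, E) p).map_source hq, by
    rwa [mem_preimage, (extChartAt 𝓘(ℝ, E) p).left_inv hq]⟩

variable [IsManifold 𝓘(ℝ, E) 1 M]

theorem isInvertible_mfderiv_chart_symm {x : E} (hx : x ∈ (extChartAt 𝓘(ℝ, E) p).target) :
    (chartSymmDeriv p x).IsInvertible := by
  have := isInvertible_mfderivWithin_extChartAt_symm (I := 𝓘(ℝ, E)) hx
  rwa [ModelWithCorners.range_eq_univ, mfderivWithin_univ] at this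

theorem mfderiv_chart_symm_chartField (X : VField E M) {x : E}
    (hx : x ∈ (extChartAt 𝓘(ℝ, E) p).target) :
    chartSymmDeriv p x (chartField p X x) =
      X ((extChartAt 𝓘(ℝ, E) p).symm x) :=
  (isInvertible_mfderiv_chart_symm hx).self_apply_inverse _

theorem chartField_eq_of_mfderiv_eq {X : VField E M} {x : E} {v : E}
    (hx : x ∈ (extChartAt 𝓘(ℝ, E) p).target)
    (h : chartSymmDeriv p x v =
      X ((extChartAt 𝓘(ℝ, E) p).symm x)) : chartField p X x = v :=
  (isInvertible_mfderiv_chart_symm hx).injective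
    ((mfderiv_chart_symm_chartField X hx).trans h.symm)

theorem chartLift_chart_symm (Z : E → E) {x : E} (hx : x ∈ (extChartAt 𝓘(ℝ, E) p).target) :
    chartLift p Z ((extChartAt 𝓘(ℝ, E) p).symm x) =
      chartSymmDeriv p x (Z x) := by
  have h1 := mfderivWithin_extChartAt_symm_comp_mfderiv_extChartAt (I := 𝓘(ℝ, E)) hx
  have h2 := mfderiv_extChartAt_comp_mfderivWithin_extChartAt_symm (I := 𝓘(ℝ, E)) hx
  rw [ModelWithCorners.range_eq_univ, mfderivWithin_univ] at h1 h2
  have hA : (mfderiv 𝓘(ℝ, E) 𝓘(ℝ, E) (extChartAt 𝓘(ℝ, E) p)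
      ((extChartAt 𝓘(ℝ, E) p).symm x)).inverse =
      mfderiv 𝓘(ℝ, E) 𝓘(ℝ, E) (extChartAt 𝓘(ℝ, E) p).symm x := ContinuousLinearMap.inverse_eq h2 h1
  have hZ : Z (extChartAt 𝓘(ℝ, E) p ((extChartAt 𝓘(ℝ, E) p).symm x)) = Z x := by
    rw [(extChartAt 𝓘(ℝ, E) p).right_inv hx]
  exact (DFunLike.congr_fun hA _).trans (congrArg _ hZ)

theorem chartField_chartLift (Z : E → E) {x : E} (hx : x ∈ (extChartAt 𝓘(ℝ, E) p).target) :
    chartField p (chartLift p Z) x = Z x :=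
  chartField_eq_of_mfderiv_eq hx (chartLift_chart_symm Z hx).symm

theorem chartLift_chartField (X : VField E M) {q : M} (hq : q ∈ (extChartAt 𝓘(ℝ, E) p).source) :
    chartLift p (chartField p X) q = X q := by
  have hx := (extChartAt 𝓘(ℝ, E) p).map_source hq
  have h := (chartLift_chart_symm (chartField p X) hx).trans (mfderiv_chart_symm_chartField X hx)
  rwa [(extChartAt 𝓘(ℝ, E) p).left_inv hq] at h

theorem mem_chartDistribution_iff {D : GenDistribution E M} (X : VField E M) {x : E}
    (hx : x ∈ (extChartAt 𝓘(ℝ, E) p).target) :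
    chartField p X x ∈ chartDistribution p D x ↔
      X ((extChartAt 𝓘(ℝ, E) p).symm x) ∈ D ((extChartAt 𝓘(ℝ, E) p).symm x) := by
  rw [← mfderiv_chart_symm_chartField X hx]
  rfl

omit [IsManifold 𝓘(ℝ, E) 1 M] in
theorem chartField_apply (X : VField E M) (x : E) : chartField p X x =
    (chartSymmDeriv p x).inverse (X ((extChartAt 𝓘(ℝ, E) p).symm x)) := rfl

omit [IsManifold 𝓘(ℝ, E) 1 M] in
theorem chartField_add_sum {m : ℕ} (f : VField E M) (g : Fin m → VField E M) (α : Fin m → M → ℝ)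
    (x : E) : chartField p (fun q => f q + ∑ i, α i q • g i q) x = chartField p f x +
      ∑ i, α i ((extChartAt 𝓘(ℝ, E) p).symm x) • chartField p (g i) x := by
  simp only [chartField_apply, map_add, map_sum, map_smul]

omit [IsManifold 𝓘(ℝ, E) 1 M] in
theorem chartField_sum {m : ℕ} (g : Fin m → VField E M) (α : Fin m → M → ℝ)
    (x : E) : chartField p (fun q => ∑ i, α i q • g i q) x =
      ∑ i, α i ((extChartAt 𝓘(ℝ, E) p).symm x) • chartField p (g i) x := by
  simp only [chartField_apply, map_sum, map_smul]

/-- The derivative of the inverse chart, as an isomorphism of tangent spaces. -/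
theorem exists_equiv_chart_symm {x : E} (hx : x ∈ (extChartAt 𝓘(ℝ, E) p).target) :
    ∃ B : E ≃ₗ[ℝ] TangentSpace 𝓘(ℝ, E) ((extChartAt 𝓘(ℝ, E) p).symm x),
      (∀ D : GenDistribution E M, chartDistribution p D x =
        (D ((extChartAt 𝓘(ℝ, E) p).symm x)).map (B.symm : _ →ₗ[ℝ] E)) ∧
      ∀ X : VField E M, chartField p X x = B.symm (X ((extChartAt 𝓘(ℝ, E) p).symm x)) := by
  obtain ⟨B, hB⟩ := isInvertible_mfderiv_chart_symm (E := E) hx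
  refine ⟨B.toLinearEquiv, fun D => ?_, fun X => ?_⟩
  · ext v
    rw [Submodule.mem_map_equiv, chartDistribution, ← hB]
    rfl
  · rw [LinearEquiv.eq_symm_apply, ← mfderiv_chart_symm_chartField X hx, ← hB]
    rfl

theorem finrank_chartDistribution (D : GenDistribution E M) {x : E}
    (hx : x ∈ (extChartAt 𝓘(ℝ, E) p).target) : Module.finrank ℝ (chartDistribution p D x) =
      Module.finrank ℝ (D ((extChartAt 𝓘(ℝ, E) p).symm x)) := by
  obtain ⟨B, hB, -⟩ := exists_equiv_chart_symm (E := E) hx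
  rw [hB]
  exact LinearEquiv.finrank_map_eq B.symm _

theorem chartDistribution_sup (D G : GenDistribution E M) {x : E}
    (hx : x ∈ (extChartAt 𝓘(ℝ, E) p).target) : chartDistribution p (fun q => G q ⊔ D q) x =
      chartDistribution p G x ⊔ chartDistribution p D x := by
  obtain ⟨B, hB, -⟩ := exists_equiv_chart_symm (E := E) hx
  simp only [hB]
  exact Submodule.map_sup _ _ _

theorem chartDistribution_span {D : GenDistribution E M} {S : Set (VField E M)} {x : E}
    (hx : x ∈ (extChartAt 𝓘(ℝ, E) p).target)
    (hD : D ((extChartAt 𝓘(ℝ, E) p).symm x) =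
      Submodule.span ℝ ((fun X : VField E M => X ((extChartAt 𝓘(ℝ, E) p).symm x)) '' S)) :
    chartDistribution p D x =
      Submodule.span ℝ ((fun Z : E → E => Z x) '' (chartField p '' S)) := by
  obtain ⟨B, hB, hB'⟩ := exists_equiv_chart_symm (E := E) hx
  rw [hB, hD, Submodule.map_span, image_image, image_image]
  simp only [hB']
  rfl

theorem chartDistribution_spanDistribution {m : ℕ} (g : Fin m → VField E M) {x : E}
    (hx : x ∈ (extChartAt 𝓘(ℝ, E) p).target) : chartDistribution p (spanDistribution g) x =
      Submodule.span ℝ (range fun i => chartField p (g i) x) := by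
  rw [chartDistribution_span (S := range g) hx]
  · rw [← range_comp, ← range_comp]; rfl
  · rw [← range_comp]; rfl

section Smooth

variable {r : WithTop ℕ∞} (hr : r = ∞ ∨ r = ω) [IsManifold 𝓘(ℝ, E) r M]
include hr

theorem contDiffOn_chartField [CompleteSpace E] {X : VField E M} (hX : IsVFieldOn r U X)
    (hU : IsOpen U) :
    ContDiffOn ℝ r (chartField p X) (chartImage E p U) := by
  intro x hx
  have h1 : ContMDiffAt 𝓘(ℝ, E) 𝓘(ℝ, E) r (extChartAt 𝓘(ℝ, E) p).symm x :=
    (contMDiffOn_extChartAt_symm p).contMDiffAt ((isOpen_extChartAt_target p).mem_nhds hx.1)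
  have hinv : (mfderiv 𝓘(ℝ, E) 𝓘(ℝ, E) (extChartAt 𝓘(ℝ, E) p).symm x).IsInvertible :=
    isInvertible_mfderiv_chart_symm (E := E) (p := p) hx.1
  have h2 := ContMDiffAt.mpullback_vectorField_preimage
    (hX.contMDiffAt (hU.mem_nhds hx.2)) h1 hinv
    (add_one_le_of_eq_infty_or_omega hr)
  have h3 : ContDiffAt ℝ r (chartField p X) x := contMDiffAt_vectorSpace_iff_contDiffAt.1 h2
  exact h3.contDiffWithinAt

theorem isVFieldOn_chartLift [CompleteSpace E] {Z : E → E} {O : Set E} (hO : IsOpen O)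
    (hZ : ContDiffOn ℝ r Z O) :
    IsVFieldOn r ((extChartAt 𝓘(ℝ, E) p).source ∩ extChartAt 𝓘(ℝ, E) p ⁻¹' O)
      (chartLift (M := M) p Z) := by
  intro q hq
  have h1 : ContMDiffAt 𝓘(ℝ, E) 𝓘(ℝ, E) r (extChartAt 𝓘(ℝ, E) p) q :=
    contMDiffAt_extChartAt' (by simpa using hq.1)
  have h2 := ContMDiffAt.mpullback_vectorField_preimage
    (V := fun x => (Z x : TangentSpace 𝓘(ℝ, E) x)) (m := r) (n := r) ?_ h1
    (isInvertible_mfderiv_extChartAt hq.1) (add_one_le_of_eq_infty_or_omega hr)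
  · exact h2.contMDiffWithinAt
  · have h3 : ContDiffAt ℝ r Z (extChartAt 𝓘(ℝ, E) p q) := hZ.contDiffAt (hO.mem_nhds hq.2)
    exact contMDiffAt_vectorSpace_iff_contDiffAt.2 h3

theorem isVFieldOn_of_contDiffOn_chartField [CompleteSpace E] {X : VField E M}
    (hUs : U ⊆ (extChartAt 𝓘(ℝ, E) p).source) {O : Set E} (hO : IsOpen O)
    (hUO : ∀ q ∈ U, extChartAt 𝓘(ℝ, E) p q ∈ O) (hX : ContDiffOn ℝ r (chartField p X) O) :
    IsVFieldOn r U X := by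
  refine ((isVFieldOn_chartLift hr hO hX).mono fun q hq => ⟨hUs hq, hUO q hq⟩).congr ?_
  intro q hq
  rw [chartLift_chartField X (hUs hq)]

theorem chartField_mlieBracket [CompleteSpace E] {X Y : VField E M} (hU : IsOpen U)
    (hX : IsVFieldOn r U X)
    (hY : IsVFieldOn r U Y) {x : E} (hx : x ∈ chartImage E p U) :
    chartField p (mlieBracket 𝓘(ℝ, E) X Y) x =
      lieBracket ℝ (chartField p X) (chartField p Y) x := by
  have hr0 : r ≠ 0 := (zero_lt_one.trans_le (one_le_of_eq_infty_or_omega hr)).ne'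
  have h1 : ContMDiffAt 𝓘(ℝ, E) 𝓘(ℝ, E) r (extChartAt 𝓘(ℝ, E) p).symm x :=
    (contMDiffOn_extChartAt_symm p).contMDiffAt ((isOpen_extChartAt_target p).mem_nhds hx.1)
  have hmin : minSmoothness ℝ 2 ≤ r := by
    rcases hr with rfl | rfl
    · simpa using WithTop.coe_le_coe.2 (le_top : (2 : ℕ∞) ≤ ⊤)
    · simp
  have : IsManifold 𝓘(ℝ, E) (minSmoothness ℝ 2) M := IsManifold.of_le hmin
  have h2 := mpullback_mlieBracket (n := r)
    ((hX.contMDiffAt (hU.mem_nhds hx.2)).mdifferentiableAt hr0)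
    ((hY.contMDiffAt (hU.mem_nhds hx.2)).mdifferentiableAt hr0) h1 hmin
  exact h2.trans ((congrFun mlieBracketWithin_eq_lieBracketWithin x).trans
    (congrFun (lieBracketWithin_univ (V := chartField p X) (W := chartField p Y)) x))

theorem contDiffOn_chartField_mlieBracket [CompleteSpace E] {X Y : VField E M} (hU : IsOpen U)
    (hX : IsVFieldOn r U X) (hY : IsVFieldOn r U Y) :
    ContDiffOn ℝ r (chartField p (mlieBracket 𝓘(ℝ, E) X Y)) (chartImage E p U) :=
  (contDiffOn_lieBracket hr (isOpen_chartImage hU) (contDiffOn_chartField hr hX hU)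
    (contDiffOn_chartField hr hY hU)).congr fun _ hx => chartField_mlieBracket hr hU hX hY hx

/-- Sections of a distribution over a subset of the chart domain, read in the chart. -/
theorem mem_sectionsOn_iff_chart [CompleteSpace E] {D : GenDistribution E M} {X : VField E M}
    (hU : IsOpen U) (hUs : U ⊆ (extChartAt 𝓘(ℝ, E) p).source) :
    X ∈ sectionsOn r U D ↔ ContDiffOn ℝ r (chartField p X) (chartImage E p U) ∧
      ∀ x ∈ chartImage E p U, chartField p X x ∈ chartDistribution p D x := by
  refine ⟨fun h => ⟨contDiffOn_chartField hr h.1 hU, fun x hx =>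
    (mem_chartDistribution_iff X hx.1).2 (h.2 _ hx.2)⟩, fun h => ⟨?_, fun q hq => ?_⟩⟩
  · exact isVFieldOn_of_contDiffOn_chartField hr hUs (isOpen_chartImage hU)
      (fun q hq => mem_chartImage (hUs hq) hq) h.1
  · have hx := mem_chartImage (E := E) (hUs hq) hq
    have h1 := (mem_chartDistribution_iff X hx.1).1 (h.2 _ hx)
    rwa [(extChartAt 𝓘(ℝ, E) p).left_inv (hUs hq)] at h1

end Smooth

end Chart

/-! ### Necessity of the bracket conditions -/

section Necessity

open Set VectorField

variable {E : Type*} [NormedAddCommGroup E] [NormedSpace ℝ E]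

theorem lieBracket_add_sum_left {m : ℕ} {f : E → E} {g : Fin m → E → E} {a : Fin m → E → ℝ}
    {Y : E → E} {x : E} (hf : DifferentiableAt ℝ f x) (hg : ∀ i, DifferentiableAt ℝ (g i) x)
    (ha : ∀ i, DifferentiableAt ℝ (a i) x) :
    lieBracket ℝ (fun y => f y + ∑ i, a i y • g i y) Y x =
      lieBracket ℝ f Y x + ∑ i, a i x • lieBracket ℝ (g i) Y x -
        ∑ i, fderiv ℝ (a i) x (Y x) • g i x := by
  have h : HasFDerivAt (fun y => f y + ∑ i, a i y • g i y) _ x :=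
    hf.hasFDerivAt.add (HasFDerivAt.fun_sum fun i _ => (ha i).hasFDerivAt.smul (hg i).hasFDerivAt)
  simp only [lieBracket, h.fderiv]
  simp [Finset.sum_add_distrib, smul_sub]
  abel

/-- The rows of an invertible matrix of functions, combined so as to give a unit vector: the `i`-th
row of the inverse matrix, which is as regular as the matrix. -/
theorem exists_contDiffOn_inverse_row {m : ℕ} {r : WithTop ℕ∞} {O : Set E}
    {β : E → GL (Fin m) ℝ}
    (hβ : ∀ i j, ContDiffOn ℝ r (fun x => (β x : Matrix (Fin m) (Fin m) ℝ) i j) O) (i : Fin m) :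
    ∃ n : E → Fin m → ℝ, ContDiffOn ℝ r n O ∧
      ∀ x j, ∑ k, n x k * (β x : Matrix (Fin m) (Fin m) ℝ) k j = if i = j then 1 else 0 := by
  let A : E → (Fin m → ℝ) →L[ℝ] (Fin m → ℝ) :=
    frameOf fun k x j => (β x : Matrix (Fin m) (Fin m) ℝ) k j
  let A' : E → (Fin m → ℝ) →L[ℝ] (Fin m → ℝ) :=
    frameOf fun k x j => ((β x)⁻¹ : GL (Fin m) ℝ) k j
  have hA : ∀ x v, A x v = Matrix.vecMul v (β x : Matrix (Fin m) (Fin m) ℝ) := fun x v => by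
    ext j; simp [A, Matrix.vecMul, dotProduct]
  have hA' : ∀ x v, A' x v = Matrix.vecMul v ((β x)⁻¹ : GL (Fin m) ℝ).1 := fun x v => by
    ext j; simp [A', Matrix.vecMul, dotProduct]
  let u : E → ((Fin m → ℝ) →L[ℝ] (Fin m → ℝ))ˣ := fun x =>
    ⟨A x, A' x, ContinuousLinearMap.ext fun v => by
        change A x (A' x v) = v
        rw [hA, hA', Matrix.vecMul_vecMul, ← Units.val_mul, inv_mul_cancel]
        simp,
      ContinuousLinearMap.ext fun v => by
        change A' x (A x v) = v
        rw [hA, hA', Matrix.vecMul_vecMul, ← Units.val_mul, mul_inv_cancel]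
        simp⟩
  have hAc : ContDiffOn ℝ r A O := contDiffOn_frameOf fun k => contDiffOn_pi.2 fun j => hβ k j
  have hinv : ContDiffOn ℝ r (fun x => Ring.inverse (A x)) O := fun x hx => by
    have h1 : ContDiffAt ℝ r Ring.inverse (A x) := contDiffAt_ringInverse ℝ (u x)
    exact h1.comp_contDiffWithinAt x (hAc x hx)
  refine ⟨fun x => Ring.inverse (A x) (Pi.single i 1), hinv.clm_apply contDiffOn_const, ?_⟩
  intro x j
  have h1 : A x (Ring.inverse (A x) (Pi.single i 1)) = Pi.single i 1 :=
    DFunLike.congr_fun (Ring.mul_inverse_cancel (A x) (u x).isUnit) _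
  have h2 := congrFun h1 j
  rw [hA] at h2
  simpa [Matrix.vecMul, dotProduct, Pi.single_apply, eq_comm] using h2

/-- If the fed-back fields preserve `D`, then the brackets of the `g i` with a section of `D` are
sections of `D` up to a combination of the `g j`. -/
theorem exists_bracket_input {m : ℕ} {r : WithTop ℕ∞} (hr : r = ∞ ∨ r = ω) {O : Set E}
    (hO : IsOpen O) {D : E → Submodule ℝ E} {g : Fin m → E → E} (hg : ∀ i, ContDiffOn ℝ r (g i) O)
    {Y : E → E} (hY : ContDiffOn ℝ r Y O) {β : E → GL (Fin m) ℝ}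
    (hβ : ∀ i j, ContDiffOn ℝ r (fun x => (β x : Matrix (Fin m) (Fin m) ℝ) i j) O)
    (h : ∀ i, ∀ x ∈ O, lieBracket ℝ
      (fun y => ∑ j, (β y : Matrix (Fin m) (Fin m) ℝ) i j • g j y) Y x ∈ D x) (i : Fin m) :
    ∃ c : Fin m → E → ℝ, (∀ j, ContDiffOn ℝ r (c j) O) ∧
      ∀ x ∈ O, lieBracket ℝ (g i) Y x - ∑ j, c j x • g j x ∈ D x := by
  have hr0 : r ≠ 0 := (zero_lt_one.trans_le (one_le_of_eq_infty_or_omega hr)).ne'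
  obtain ⟨n, hn, hnβ⟩ := exists_contDiffOn_inverse_row hβ i
  refine ⟨fun j x => ∑ k, n x k *
    fderiv ℝ (fun x => (β x : Matrix (Fin m) (Fin m) ℝ) k j) x (Y x), fun j => ?_, fun x hx => ?_⟩
  · refine ContDiffOn.sum fun k _ => ((contDiff_apply ℝ ℝ k).comp_contDiffOn hn).mul ?_
    exact ((hβ k j).fderiv_of_isOpen hO (add_one_le_of_eq_infty_or_omega hr)).clm_apply hY
  · have hd : ∀ {h : E → E}, ContDiffOn ℝ r h O → DifferentiableAt ℝ h x := fun hh =>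
      (hh.differentiableOn hr0 x hx).differentiableAt (hO.mem_nhds hx)
    have key : ∀ k, lieBracket ℝ
        (fun y => ∑ j, (β y : Matrix (Fin m) (Fin m) ℝ) k j • g j y) Y x =
        ∑ j, (β x : Matrix (Fin m) (Fin m) ℝ) k j • lieBracket ℝ (g j) Y x -
          ∑ j, fderiv ℝ (fun x => (β x : Matrix (Fin m) (Fin m) ℝ) k j) x (Y x) • g j x := by
      intro k
      have := lieBracket_add_sum_left (Y := Y) (f := 0)
        (a := fun j y => (β y : Matrix (Fin m) (Fin m) ℝ) k j)
        (differentiableAt_const (0 : E)) (fun j => hd (hg j)) (fun j =>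
          ((hβ k j).differentiableOn hr0 x hx).differentiableAt (hO.mem_nhds hx))
      simpa using this
    have hmem := sum_mem (t := Finset.univ) fun k _ => (D x).smul_mem (n x k) (h k x hx)
    convert hmem using 1
    simp only [key, smul_sub, Finset.sum_sub_distrib, Finset.smul_sum, smul_smul, Finset.sum_smul]
    rw [Finset.sum_comm (f := fun k j => (n x k * (β x : Matrix (Fin m) (Fin m) ℝ) k j) • _)]
    simp only [← Finset.sum_smul, hnβ]
    rw [Finset.sum_comm]
    simp [Finset.sum_smul]

/-- The analogue for the drift, given the statement for the inputs. -/
theorem exists_bracket_drift {m : ℕ} {r : WithTop ℕ∞} (hr : r = ∞ ∨ r = ω) {O : Set E}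
    (hO : IsOpen O) {D : E → Submodule ℝ E} {g : Fin m → E → E} (hg : ∀ i, ContDiffOn ℝ r (g i) O)
    {f : E → E} (hf : ContDiffOn ℝ r f O)
    {Y : E → E} (hY : ContDiffOn ℝ r Y O) {a : Fin m → E → ℝ} (ha : ∀ i, ContDiffOn ℝ r (a i) O)
    (h : ∀ x ∈ O, lieBracket ℝ (fun y => f y + ∑ j, a j y • g j y) Y x ∈ D x)
    (hgD : ∀ i, ∃ c : Fin m → E → ℝ, (∀ j, ContDiffOn ℝ r (c j) O) ∧
      ∀ x ∈ O, lieBracket ℝ (g i) Y x - ∑ j, c j x • g j x ∈ D x) :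
    ∃ c : Fin m → E → ℝ, (∀ j, ContDiffOn ℝ r (c j) O) ∧
      ∀ x ∈ O, lieBracket ℝ f Y x - ∑ j, c j x • g j x ∈ D x := by
  have hr0 : r ≠ 0 := (zero_lt_one.trans_le (one_le_of_eq_infty_or_omega hr)).ne'
  choose c hc hcD using hgD
  refine ⟨fun j x => fderiv ℝ (a j) x (Y x) - ∑ k, a k x * c k j x, fun j => ?_, fun x hx => ?_⟩
  · exact (((ha j).fderiv_of_isOpen hO (add_one_le_of_eq_infty_or_omega hr)).clm_apply hY).sub
      (ContDiffOn.sum fun k _ => (ha k).mul (hc k j))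
  · have hd : ∀ {h : E → E}, ContDiffOn ℝ r h O → DifferentiableAt ℝ h x := fun hh =>
      (hh.differentiableOn hr0 x hx).differentiableAt (hO.mem_nhds hx)
    have h1 := h x hx
    rw [lieBracket_add_sum_left (hd hf) (fun i => hd (hg i)) (fun i =>
      ((ha i).differentiableOn hr0 x hx).differentiableAt (hO.mem_nhds hx))] at h1
    have hmem := sub_mem h1
      (sum_mem (t := Finset.univ) fun k _ => (D x).smul_mem (a k x) (hcD k x hx))
    convert hmem using 1
    simp only [smul_sub, Finset.sum_sub_distrib, Finset.smul_sum, smul_smul, sub_smul,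
      Finset.sum_smul]
    rw [Finset.sum_comm (f := fun k j => (a k x * c k j x) • _)]
    abel

variable {M : Type*} [TopologicalSpace M] [ChartedSpace E M] [CompleteSpace E]
  [IsManifold 𝓘(ℝ, E) 1 M]

/-- A field whose expression in the chart is, up to a combination of the `g j` with regular
coefficients, a section of `D`. -/
theorem mem_sectionsOn_add_of_chart {m : ℕ} {r : WithTop ℕ∞} (hr : r = ∞ ∨ r = ω)
    [IsManifold 𝓘(ℝ, E) r M] {p : M} {U : Set M} (hU : IsOpen U)
    (hUs : U ⊆ (extChartAt 𝓘(ℝ, E) p).source) {D : GenDistribution E M} {g : Fin m → VField E M}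
    (hg : ∀ i, IsVFieldOn r U (g i)) {X : VField E M}
    (hX : ContDiffOn ℝ r (chartField p X) (chartImage E p U))
    (h : ∃ c : Fin m → E → ℝ, (∀ j, ContDiffOn ℝ r (c j) (chartImage E p U)) ∧
      ∀ x ∈ chartImage E p U, chartField p X x - ∑ j, c j x • chartField p (g j) x ∈
        chartDistribution p D x) :
    X ∈ sectionsOn r U D + sectionsOn r U (spanDistribution g) := by
  obtain ⟨c, hc, hcD⟩ := h
  let Z : VField E M := fun q => ∑ j, c j (extChartAt 𝓘(ℝ, E) p q) • g j q
  have hZ : ∀ x ∈ chartImage E p U, chartField p Z x = ∑ j, c j x • chartField p (g j) x := by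
    intro x hx
    rw [chartField_sum g (fun j q => c j (extChartAt 𝓘(ℝ, E) p q))]
    simp only [(extChartAt 𝓘(ℝ, E) p).right_inv hx.1]
  have hZc : ContDiffOn ℝ r (chartField p Z) (chartImage E p U) := by
    refine ContDiffOn.congr (ContDiffOn.sum fun j _ =>
      ContDiffOn.fun_smul (hc j) (contDiffOn_chartField hr (hg j) hU)) hZ
  have hsub : ∀ x, chartField p (X - Z) x = chartField p X x - chartField p Z x := fun x => by
    simp only [chartField_apply, Pi.sub_apply, map_sub]
  refine Set.mem_add.2 ⟨X - Z, (mem_sectionsOn_iff_chart hr hU hUs).2 ⟨?_, ?_⟩, Z,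
    (mem_sectionsOn_iff_chart hr hU hUs).2 ⟨hZc, ?_⟩, sub_add_cancel X Z⟩
  · exact (hX.sub hZc).congr fun x _ => hsub x
  · intro x hx
    rw [hsub, hZ x hx]
    exact hcD x hx
  · intro x hx
    rw [hZ x hx, chartDistribution_spanDistribution g hx.1]
    exact sum_mem fun j _ => Submodule.smul_mem _ _ (Submodule.subset_span ⟨j, rfl⟩)

/-- Necessity of the bracket conditions, on any neighbourhood within the chart domain on which the
feedback is defined. -/
theorem bracket_subset_of_locallyControlledInvariantAt {r : WithTop ℕ∞} (hr : r = ∞ ∨ r = ω)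
    [IsManifold 𝓘(ℝ, E) r M] {m : ℕ} {f : VField E M} {g : Fin m → VField E M}
    (hf : IsVFieldOn r univ f) (hg : ∀ i, IsVFieldOn r univ (g i)) {D : GenDistribution E M} {p : M}
    (h : LocallyControlledInvariantAt r f g D p) :
    ∀ W ∈ 𝓝 p, ∃ U : Set M, IsOpen U ∧ p ∈ U ∧ U ⊆ W ∧
        (∀ i, bracketSet (g i) (sectionsOn r U D) ⊆
          sectionsOn r U D + sectionsOn r U (spanDistribution g)) ∧
        bracketSet f (sectionsOn r U D) ⊆
          sectionsOn r U D + sectionsOn r U (spanDistribution g) := by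
  intro W hW
  obtain ⟨U, hU, hpU, hUW, α, β, ⟨hα, hβ⟩, hfD, hgD⟩ :=
    h (W ∩ (extChartAt 𝓘(ℝ, E) p).source) (Filter.inter_mem hW (extChartAt_source_mem_nhds p))
  have hUs : U ⊆ (extChartAt 𝓘(ℝ, E) p).source := hUW.trans inter_subset_right
  have hO := isOpen_chartImage (E := E) (p := p) hU
  have hfU := hf.mono (subset_univ U)
  have hgU : ∀ i, IsVFieldOn r U (g i) := fun i => (hg i).mono (subset_univ U)
  -- functions on `U` read in the chart
  have hfun : ∀ φ : M → ℝ, IsFunctionOn (E := E) r U φ →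
      ContDiffOn ℝ r (fun x => φ ((extChartAt 𝓘(ℝ, E) p).symm x)) (chartImage E p U) := by
    intro φ hφ
    have h1 : ContMDiffOn 𝓘(ℝ, E) 𝓘(ℝ, E) r (extChartAt 𝓘(ℝ, E) p).symm (chartImage E p U) :=
      (contMDiffOn_extChartAt_symm p).mono inter_subset_left
    exact contMDiffOn_iff_contDiffOn.1 (ContMDiffOn.comp hφ h1 fun x hx => hx.2)
  have hgc : ∀ i, ContDiffOn ℝ r (chartField p (g i)) (chartImage E p U) := fun i =>
    contDiffOn_chartField hr (hgU i) hU
  have hfc := contDiffOn_chartField (p := p) hr hfU hU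
  have hsum : ∀ φ : Fin m → M → ℝ, (∀ i, IsFunctionOn (E := E) r U (φ i)) →
      ContDiffOn ℝ r (fun x => ∑ i, φ i ((extChartAt 𝓘(ℝ, E) p).symm x) • chartField p (g i) x)
        (chartImage E p U) := fun φ hφ =>
    ContDiffOn.sum fun i _ => ContDiffOn.fun_smul (hfun _ (hφ i)) (hgc i)
  have hfa : IsVFieldOn r U (feedbackDrift f g α) :=
    isVFieldOn_of_contDiffOn_chartField hr hUs hO (fun q hq => mem_chartImage (hUs hq) hq)
      ((hfc.add (hsum α hα)).congr fun x _ => chartField_add_sum f g α x)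
  have hgb : ∀ i, IsVFieldOn r U (feedbackInput g β i) := fun i =>
    isVFieldOn_of_contDiffOn_chartField hr hUs hO (fun q hq => mem_chartImage (hUs hq) hq)
      ((hsum _ (hβ i)).congr fun x _ => chartField_sum g
        (fun j q => (β q : Matrix (Fin m) (Fin m) ℝ) i j) x)
  have hgY : ∀ Y ∈ sectionsOn r U D, ∀ i, ∃ c : Fin m → E → ℝ,
      (∀ j, ContDiffOn ℝ r (c j) (chartImage E p U)) ∧ ∀ x ∈ chartImage E p U,
        lieBracket ℝ (chartField p (g i)) (chartField p Y) x -
          ∑ j, c j x • chartField p (g j) x ∈ chartDistribution p D x := by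
    intro Y hY
    refine exists_bracket_input hr hO hgc (contDiffOn_chartField hr hY.1 hU)
      (β := fun x => β ((extChartAt 𝓘(ℝ, E) p).symm x)) (fun i j => hfun _ (hβ i j)) ?_
    intro i x hx
    have h1 := ((mem_sectionsOn_iff_chart hr hU hUs).1 (hgD i ⟨Y, hY, rfl⟩)).2 x hx
    rw [chartField_mlieBracket hr hU (hgb i) hY.1 hx] at h1
    convert h1 using 2
    exact (funext fun x => chartField_sum g
      (fun j q => (β q : Matrix (Fin m) (Fin m) ℝ) i j) x).symm
  refine ⟨U, hU, hpU, hUW.trans inter_subset_left, fun i => ?_, ?_⟩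
  · rintro _ ⟨Y, hY, rfl⟩
    refine mem_sectionsOn_add_of_chart hr hU hUs hgU
      (contDiffOn_chartField_mlieBracket hr hU (hgU i) hY.1) ?_
    obtain ⟨c, hc, hcD⟩ := hgY Y hY i
    refine ⟨c, hc, fun x hx => ?_⟩
    rw [chartField_mlieBracket hr hU (hgU i) hY.1 hx]
    exact hcD x hx
  · rintro _ ⟨Y, hY, rfl⟩
    refine mem_sectionsOn_add_of_chart hr hU hUs hgU
      (contDiffOn_chartField_mlieBracket hr hU hfU hY.1) ?_
    obtain ⟨c, hc, hcD⟩ := exists_bracket_drift hr hO hgc hfc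
      (contDiffOn_chartField hr hY.1 hU) (fun i => hfun _ (hα i)) (D := chartDistribution p D) (by
        intro x hx
        have h1 := ((mem_sectionsOn_iff_chart hr hU hUs).1 (hfD ⟨Y, hY, rfl⟩)).2 x hx
        rw [chartField_mlieBracket hr hU hfa hY.1 hx] at h1
        convert h1 using 2
        exact (funext fun x => chartField_add_sum f g α x).symm) (hgY Y hY)
    refine ⟨c, hc, fun x hx => ?_⟩
    rw [chartField_mlieBracket hr hU hfU hY.1 hx]
    exact hcD x hx

end Necessity

/-! ### Sufficiency of the bracket conditions -/

section Sufficiency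

open Set VectorField

theorem finrank_map_mkQ_add_finrank {V : Type*} [AddCommGroup V] [Module ℝ V]
    [FiniteDimensional ℝ V] {D S : Submodule ℝ V} (h : D ≤ S) :
    Module.finrank ℝ (S.map D.mkQ) + Module.finrank ℝ D = Module.finrank ℝ S := by
  have h1 := LinearMap.finrank_range_add_finrank_ker (D.mkQ.domRestrict S)
  have h2 : LinearMap.ker (D.mkQ.domRestrict S) = D.comap S.subtype := by
    ext v; simp
  rwa [LinearMap.range_domRestrict, h2, (Submodule.comapSubtypeEquivOfLe h).finrank_eq] at h1

variable {E : Type*} [NormedAddCommGroup E] [NormedSpace ℝ E] [FiniteDimensional ℝ E]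

/-- The pair of feedback functions for a system on an open subset of `E`. The rows of `β` come from
applying `exists_feedback_of_finrank_eq` with each `g i` in place of the drift: the resulting
coefficients vanish at `x₀`, so that `β x₀ = 1` and `β` is invertible near `x₀`. -/
theorem exists_regular_feedback {F : Type} [NormedAddCommGroup F] [NormedSpace ℝ F]
    [FiniteDimensional ℝ F] {m : ℕ} {r : WithTop ℕ∞} (hr : r = ∞ ∨ r = ω)
    {O : Set E} (hO : IsOpen O) {x₀ : E} (hx₀ : x₀ ∈ O) {X : E → F →L[ℝ] E}
    (hX : ContDiffOn ℝ r X O) (hXinj : ∀ x ∈ O, Function.Injective (X x))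
    {D : E → Submodule ℝ E} (hD : ∀ x ∈ O, D x = LinearMap.range (X x : F →ₗ[ℝ] E))
    {g : Fin m → E → E} (hg : ∀ i, ContDiffOn ℝ r (g i) O)
    (hrank : ∀ x ∈ O, Module.finrank ℝ ↥(Submodule.span ℝ (range fun i => g i x) ⊔ D x) =
      Module.finrank ℝ ↥(Submodule.span ℝ (range fun i => g i x₀) ⊔ D x₀))
    (hXX : ∀ x ∈ O, ∀ a b, lieBracket ℝ (fun y => X y a) (fun y => X y b) x ∈ D x)
    (hXg : ∀ i, ∀ x ∈ O, ∀ a, lieBracket ℝ (fun y => X y a) (g i) x ∈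
      Submodule.span ℝ (range fun i => g i x) ⊔ D x)
    {f : E → E} (hf : ContDiffOn ℝ r f O)
    (hXf : ∀ x ∈ O, ∀ a, lieBracket ℝ (fun y => X y a) f x ∈
      Submodule.span ℝ (range fun i => g i x) ⊔ D x) :
    ∃ (O' : Set E) (α : E → Fin m → ℝ) (β : E → GL (Fin m) ℝ), IsOpen O' ∧ x₀ ∈ O' ∧ O' ⊆ O ∧
      ContDiffOn ℝ r α O' ∧
      (∀ i j, ContDiffOn ℝ r (fun x => (β x : Matrix (Fin m) (Fin m) ℝ) i j) O') ∧
      (∀ x ∈ O', ∀ a, lieBracket ℝ (fun y => X y a) (fun y => f y + ∑ j, α y j • g j y) x ∈ D x) ∧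
      ∀ i, ∀ x ∈ O', ∀ a, lieBracket ℝ (fun y => X y a)
        (fun y => ∑ j, (β y : Matrix (Fin m) (Fin m) ℝ) i j • g j y) x ∈ D x := by
  classical
  obtain ⟨O₁, α, hO₁, hx₁, hO₁O, hα, -, hαD⟩ :=
    exists_feedback_of_finrank_eq hr hO hx₀ hX hXinj hD hg hrank hXX hXg hf hXf
  choose O₂ γ hO₂ hx₂ hO₂O hγ hγ0 hγD using fun i =>
    exists_feedback_of_finrank_eq hr hO hx₀ hX hXinj hD hg hrank hXX hXg (hg i) (hXg i)
  let B : E → Matrix (Fin m) (Fin m) ℝ := fun x => 1 + Matrix.of fun i => γ i x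
  let V : Set E := O₁ ∩ ⋂ i, O₂ i
  have hV : IsOpen V := hO₁.inter (isOpen_iInter_of_finite hO₂)
  have hVO₂ : ∀ i, V ⊆ O₂ i := fun i => inter_subset_right.trans (iInter_subset _ i)
  have hB : ∀ i j, ContDiffOn ℝ r (fun x => B x i j) V := fun i j =>
    contDiffOn_const.add ((contDiff_apply ℝ ℝ j).comp_contDiffOn ((hγ i).mono (hVO₂ i)))
  have hdet : ContinuousOn (fun x => (B x).det) V :=
    (continuous_id.matrix_det).comp_continuousOn
      (continuousOn_pi.2 fun i => continuousOn_pi.2 fun j => (hB i j).continuousOn)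
  have hB₀ : B x₀ = 1 := by
    ext i j; simp [B, hγ0]
  let O' : Set E := V ∩ (fun x => (B x).det) ⁻¹' {0}ᶜ
  have hO' : IsOpen O' := hdet.isOpen_inter_preimage hV isOpen_compl_singleton
  let β : E → GL (Fin m) ℝ := fun x =>
    if h : (B x).det ≠ 0 then Matrix.GeneralLinearGroup.mkOfDetNeZero (B x) h else 1
  have hβ : ∀ x ∈ O', (β x : Matrix (Fin m) (Fin m) ℝ) = B x := fun x hx => by
    have h : (B x).det ≠ 0 := hx.2
    simp only [β, dif_pos h]
    rfl
  refine ⟨O', α, β, hO', ⟨⟨hx₁, mem_iInter.2 hx₂⟩, by simp [hB₀]⟩,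
    fun x hx => hO₁O hx.1.1, hα.mono fun x hx => hx.1.1, fun i j => ?_,
    fun x hx => hαD x hx.1.1, fun i x hx a => ?_⟩
  · exact ((hB i j).mono inter_subset_left).congr fun x hx => by rw [hβ x hx]
  · have h := hγD i x (hVO₂ i hx.1) a
    rwa [lieBracket_congr_nhds (Filter.EventuallyEq.refl _ _)
      (W' := fun y => g i y + ∑ j, γ i y j • g j y)]
    filter_upwards [hO'.mem_nhds hx] with y hy
    simp [hβ y hy, B, add_smul, Finset.sum_add_distrib, Matrix.one_apply]

variable {M : Type*} [TopologicalSpace M] [ChartedSpace E M]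

/-- The dimension of `G + D` is constant near a regular point of `(G + D) / D`. -/
theorem finrank_spanDistribution_sup {m : ℕ} {g : Fin m → VField E M} {D : GenDistribution E M}
    {p q : M}
    (h : Module.finrank ℝ (quotientSubbundle (spanDistribution g) D q) =
      Module.finrank ℝ (quotientSubbundle (spanDistribution g) D p))
    (hD : Module.finrank ℝ (D q) = Module.finrank ℝ (D p)) :
    Module.finrank ℝ ↥(spanDistribution g q ⊔ D q) =
      Module.finrank ℝ ↥(spanDistribution g p ⊔ D p) := by
  have : ∀ x : M, FiniteDimensional ℝ (TangentSpace 𝓘(ℝ, E) x) := fun _ =>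
    inferInstanceAs (FiniteDimensional ℝ E)
  have h1 : ∀ x : M, Module.finrank ℝ (quotientSubbundle (spanDistribution g) D x) +
      Module.finrank ℝ (D x) = Module.finrank ℝ ↥(spanDistribution g x ⊔ D x) := fun x =>
    finrank_map_mkQ_add_finrank le_sup_right
  rw [← h1, ← h1, h, hD]

variable [IsManifold 𝓘(ℝ, E) 1 M]

/-- Sufficiency of the bracket conditions: applied to the fields of a frame of `D`, they give the
hypotheses of `exists_regular_feedback` in the chart. -/
theorem locallyControlledInvariantAt_of_bracket_subset {r : WithTop ℕ∞} (hr : r = ∞ ∨ r = ω)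
    [IsManifold 𝓘(ℝ, E) r M] {m : ℕ} {f : VField E M} {g : Fin m → VField E M}
    (hf : IsVFieldOn r univ f) (hg : ∀ i, IsVFieldOn r univ (g i)) {D : GenDistribution E M}
    (hD : IsInvolutiveRegularDistribution r D) {p : M}
    (hp : IsRegularPoint (quotientSubbundle (spanDistribution g) D) p)
    (h : ∀ W ∈ 𝓝 p, ∃ U : Set M, IsOpen U ∧ p ∈ U ∧ U ⊆ W ∧
        (∀ i, bracketSet (g i) (sectionsOn r U D) ⊆
          sectionsOn r U D + sectionsOn r U (spanDistribution g)) ∧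
        bracketSet f (sectionsOn r U D) ⊆
          sectionsOn r U D + sectionsOn r U (spanDistribution g)) :
    LocallyControlledInvariantAt r f g D p := by
  have : CompleteSpace E := FiniteDimensional.complete ℝ E
  have h1r := one_le_of_eq_infty_or_omega hr
  intro W hW
  obtain ⟨U₁, hU₁, hp₁, S, hS, hDS⟩ := hD.isOfClass p
  obtain ⟨U₂, hU₂, hp₂, hrankD⟩ := hD.regular p
  obtain ⟨U₃, hU₃, hp₃, hrankG⟩ := hp
  have hsp := mem_extChartAt_source (I := 𝓘(ℝ, E)) p
  have hsymm : (extChartAt 𝓘(ℝ, E) p).symm (extChartAt 𝓘(ℝ, E) p p) = p :=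
    (extChartAt 𝓘(ℝ, E) p).left_inv hsp
  -- a frame of `D` in the chart
  obtain ⟨O₁, d, X, hO₁, hx₁, -, hX, hXD⟩ := exists_frame (r := r)
    (isOpen_chartImage (E := E) (p := p) (hU₁.inter hU₂)) (mem_chartImage hsp ⟨hp₁, hp₂⟩)
    (D := chartDistribution p D) (S := chartField p '' S)
    (by
      rintro _ ⟨V, hV, rfl⟩
      exact (contDiffOn_chartField hr (hS V hV) hU₁).mono fun x hx => ⟨hx.1, hx.2.1⟩)
    (fun x hx => chartDistribution_span hx.1 (hDS _ hx.2.1))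
    (fun x hx => by
      rw [finrank_chartDistribution D hx.1, hrankD _ hx.2.2,
        finrank_chartDistribution D ((extChartAt 𝓘(ℝ, E) p).map_source hsp), hsymm])
  -- a neighbourhood of `p` small enough for the frame, the ranks and the chart
  obtain ⟨U, hU, hpU, hUW, hgU, hfU⟩ := h
    (W ∩ ((extChartAt 𝓘(ℝ, E) p).source ∩ extChartAt 𝓘(ℝ, E) p ⁻¹' O₁) ∩ (U₂ ∩ U₃))
    (Filter.inter_mem (Filter.inter_mem hW (((continuousOn_extChartAt p).isOpen_inter_preimage
      (isOpen_extChartAt_source p) hO₁).mem_nhds ⟨hsp, hx₁⟩))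
      ((hU₂.inter hU₃).mem_nhds ⟨hp₂, hp₃⟩))
  have hUs : U ⊆ (extChartAt 𝓘(ℝ, E) p).source := fun q hq => (hUW hq).1.2.1
  have hO := isOpen_chartImage (E := E) (p := p) hU
  have hx₀ := mem_chartImage (E := E) hsp hpU
  have hOO₁ : chartImage E p U ⊆ O₁ := fun x hx => by
    have h1 := (hUW hx.2).1.2.2
    rwa [mem_preimage, (extChartAt 𝓘(ℝ, E) p).right_inv hx.1] at h1
  have hfV := hf.mono (subset_univ U)
  have hgV : ∀ i, IsVFieldOn r U (g i) := fun i => (hg i).mono (subset_univ U)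
  have hsup : ∀ x ∈ chartImage E p U,
      Submodule.span ℝ (range fun i => chartField p (g i) x) ⊔ chartDistribution p D x =
        chartDistribution p (fun q => spanDistribution g q ⊔ D q) x := fun x hx => by
    rw [chartDistribution_sup D _ hx.1, chartDistribution_spanDistribution g hx.1]
  have hrank : ∀ x ∈ chartImage E p U, Module.finrank ℝ
      ↥(Submodule.span ℝ (range fun i => chartField p (g i) x) ⊔ chartDistribution p D x) =
      Module.finrank ℝ ↥(spanDistribution g p ⊔ D p) := fun x hx => by
    rw [hsup x hx, finrank_chartDistribution _ hx.1]
    exact finrank_spanDistribution_sup (hrankG _ (hUW hx.2).2.2) (hrankD _ (hUW hx.2).2.1)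
  -- the fields of the frame are sections of `D`, to which the hypotheses apply
  have hcol : ∀ a x, x ∈ chartImage E p U →
      chartField p (chartLift (M := M) p fun y => X y a) x = X x a := fun a x hx =>
    chartField_chartLift _ hx.1
  have hXa : ∀ a, chartLift p (fun y => X y a) ∈ sectionsOn r U D := fun a => by
    refine (mem_sectionsOn_iff_chart hr hU hUs).2 ⟨?_, fun x hx => ?_⟩
    · exact ((hX.mono hOO₁).clm_apply contDiffOn_const).congr fun x hx => hcol a x hx
    · rw [hcol a x hx, (hXD x (hOO₁ hx)).2]
      exact ⟨a, rfl⟩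
  have hcolE : ∀ a x, x ∈ chartImage E p U →
      chartField p (chartLift (M := M) p fun y => X y a) =ᶠ[𝓝 x] fun y => X y a := fun a x hx => by
    filter_upwards [hO.mem_nhds hx] with y hy using hcol a y hy
  have hXX : ∀ x ∈ chartImage E p U, ∀ a b,
      lieBracket ℝ (fun y => X y a) (fun y => X y b) x ∈ chartDistribution p D x := by
    intro x hx a b
    have h1 := hD.involutive U hU _ (hXa a) ⟨_, hXa b, rfl⟩
    have h2 := ((mem_sectionsOn_iff_chart hr hU hUs).1 h1).2 x hx
    rwa [chartField_mlieBracket hr hU (hXa a).1 (hXa b).1 hx,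
      lieBracket_congr_nhds (hcolE a x hx) (hcolE b x hx)] at h2
  have hXY : ∀ Y : VField E M, IsVFieldOn r U Y → bracketSet Y (sectionsOn r U D) ⊆
      sectionsOn r U D + sectionsOn r U (spanDistribution g) →
      ∀ x ∈ chartImage E p U, ∀ a, lieBracket ℝ (fun y => X y a) (chartField p Y) x ∈
        Submodule.span ℝ (range fun i => chartField p (g i) x) ⊔ chartDistribution p D x := by
    intro Y hY hYD x hx a
    obtain ⟨A, hA, B, hB, hAB⟩ := Set.mem_add.1 (hYD ⟨_, hXa a, rfl⟩)
    replace hAB : A + B = mlieBracket 𝓘(ℝ, E) Y (chartLift p fun y => X y a) := hAB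
    have h1 : mlieBracket 𝓘(ℝ, E) Y (chartLift p fun y => X y a)
        ((extChartAt 𝓘(ℝ, E) p).symm x) ∈ spanDistribution g ((extChartAt 𝓘(ℝ, E) p).symm x) ⊔
          D ((extChartAt 𝓘(ℝ, E) p).symm x) := by
      rw [← hAB, add_comm]
      exact Submodule.add_mem_sup (hB.2 _ hx.2) (hA.2 _ hx.2)
    have h2 := (mem_chartDistribution_iff
      (D := fun q => spanDistribution g q ⊔ D q) _ hx.1).2 h1
    rw [chartField_mlieBracket hr hU hY (hXa a).1 hx, ← hsup x hx,
      lieBracket_congr_nhds (Filter.EventuallyEq.refl _ _) (hcolE a x hx)] at h2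
    rw [lieBracket_swap]
    exact neg_mem h2
  obtain ⟨O', α, β, hO', hx', hO'O, hα, hβ, hαD, hβD⟩ := exists_regular_feedback hr hO hx₀
    (hX.mono hOO₁) (fun x hx => (hXD x (hOO₁ hx)).1) (fun x hx => (hXD x (hOO₁ hx)).2)
    (fun i => contDiffOn_chartField hr (hgV i) hU)
    (fun x hx => (hrank x hx).trans (hrank _ hx₀).symm) hXX
    (fun i => hXY (g i) (hgV i) (hgU i)) (contDiffOn_chartField hr hfV hU) (hXY f hfV hfU)
  -- the feedback functions on the manifold
  let e := extChartAt 𝓘(ℝ, E) p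
  have hU' : IsOpen (e.source ∩ e ⁻¹' O') :=
    (continuousOn_extChartAt p).isOpen_inter_preimage (isOpen_extChartAt_source p) hO'
  have hU's : e.source ∩ e ⁻¹' O' ⊆ (extChartAt 𝓘(ℝ, E) p).source := inter_subset_left
  have hU'U : e.source ∩ e ⁻¹' O' ⊆ U := fun q hq => by
    have h1 := (hO'O hq.2).2
    rwa [mem_preimage, e.left_inv hq.1] at h1
  have himage : chartImage E p (e.source ∩ e ⁻¹' O') ⊆ O' := fun x hx => by
    have h1 := hx.2.2
    rwa [mem_preimage, e.right_inv hx.1] at h1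
  have hfun : ∀ φ : E → ℝ, ContDiffOn ℝ r φ O' →
      IsFunctionOn (E := E) r (e.source ∩ e ⁻¹' O') (fun q => φ (e q)) := by
    intro φ hφ
    have h1 : ContMDiffOn 𝓘(ℝ, E) 𝓘(ℝ, E) r e (e.source ∩ e ⁻¹' O') :=
      (contMDiffOn_extChartAt (I := 𝓘(ℝ, E)) (n := r) (x := p)).mono fun q hq => by
        simpa [e] using hq.1
    exact ContMDiffOn.comp (contMDiffOn_iff_contDiffOn.2 hφ) h1 fun q hq => hq.2
  have hcongr : ∀ x ∈ chartImage E p (e.source ∩ e ⁻¹' O'), ∀ᶠ y in 𝓝 x,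
      e ((extChartAt 𝓘(ℝ, E) p).symm y) = y := fun x hx => by
    filter_upwards [(isOpen_extChartAt_target p).mem_nhds hx.1] with y hy using e.right_inv hy
  -- a field whose expression in the chart maps the frame into `D` preserves the sections of `D`
  have hsec : ∀ Y : VField E M, ∀ Y' : E → E, ContDiffOn ℝ r Y' O' →
      (∀ x, e (e.symm x) = x → chartField p Y x = Y' x) →
      (∀ x ∈ O', ∀ a, lieBracket ℝ (fun y => X y a) Y' x ∈ chartDistribution p D x) →
      bracketSet Y (sectionsOn r (e.source ∩ e ⁻¹' O') D) ⊆
        sectionsOn r (e.source ∩ e ⁻¹' O') D := by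
    rintro Y Y' hY' hYY' hXY' _ ⟨Z, hZ, rfl⟩
    have hYE : ∀ x ∈ chartImage E p (e.source ∩ e ⁻¹' O'), chartField p Y =ᶠ[𝓝 x] Y' :=
      fun x hx => (hcongr x hx).mono fun y hy => hYY' y hy
    have hYV : IsVFieldOn r (e.source ∩ e ⁻¹' O') Y :=
      isVFieldOn_of_contDiffOn_chartField hr hU's (isOpen_chartImage hU')
        (fun q hq => mem_chartImage hq.1 hq)
        ((hY'.mono himage).congr fun x hx => (hYE x hx).eq_of_nhds)
    have hZ' := (mem_sectionsOn_iff_chart hr hU' hU's).1 hZ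
    refine (mem_sectionsOn_iff_chart hr hU' hU's).2
      ⟨contDiffOn_chartField_mlieBracket hr hU' hYV hZ.1, fun x hx => ?_⟩
    rw [chartField_mlieBracket hr hU' hYV hZ.1 hx]
    have hsub : chartImage E p (e.source ∩ e ⁻¹' O') ⊆ O₁ := himage.trans (hO'O.trans hOO₁)
    refine lieBracket_mem_of_frame (isOpen_chartImage hU') ((hX.mono hsub).of_le h1r)
      (fun y hy => (hXD y (hsub hy)).1) (fun y hy => (hXD y (hsub hy)).2) hx (fun a => ?_)
      (hZ'.1.of_le h1r) hZ'.2
    rw [lieBracket_congr_nhds (Filter.EventuallyEq.refl _ _) (hYE x hx)]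
    exact hXY' x (himage hx) a
  have hαi : ∀ i, ContDiffOn ℝ r (fun x => α x i) O' := fun i =>
    (contDiff_apply ℝ ℝ i).comp_contDiffOn hα
  have hgO' : ∀ i, ContDiffOn ℝ r (chartField p (g i)) O' := fun i =>
    (contDiffOn_chartField hr (hgV i) hU).mono hO'O
  refine ⟨e.source ∩ e ⁻¹' O', hU', ⟨hsp, hx'⟩, fun q hq => (hUW (hU'U hq)).1.1,
    fun i q => α (e q) i, fun q => β (e q), ⟨fun i => hfun _ (hαi i), fun i j => hfun _ (hβ i j)⟩,
    hsec _ (fun y => chartField p f y + ∑ j, α y j • chartField p (g j) y) ?_ ?_ hαD,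
    fun i => hsec _ (fun y => ∑ j, (β y : Matrix (Fin m) (Fin m) ℝ) i j • chartField p (g j) y)
      ?_ ?_ (hβD i)⟩
  · exact ((contDiffOn_chartField hr hfV hU).mono hO'O).add
      (ContDiffOn.sum fun j _ => ContDiffOn.fun_smul (hαi j) (hgO' j))
  · intro x hx
    refine (chartField_add_sum f g (fun i q => α (e q) i) x).trans ?_
    simp only [e] at hx ⊢
    rw [hx]
  · exact ContDiffOn.sum fun j _ => ContDiffOn.fun_smul (hβ i j) (hgO' j)
  · intro x hx
    refine (chartField_sum g (fun j q => (β (e q) : Matrix (Fin m) (Fin m) ℝ) i j) x).trans ?_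
    simp only [e] at hx ⊢
    rw [hx]

end Sufficiency

end ControlledInvariance

theorem mainTheorem2 {E : Type*} [NormedAddCommGroup E] [NormedSpace ℝ E] [FiniteDimensional ℝ E]
    {M : Type*} [TopologicalSpace M] [T2Space M] [ParacompactSpace M] [ChartedSpace E M]
    (r : WithTop ℕ∞) (hr : r = ∞ ∨ r = ω)
    [IsManifold 𝓘(ℝ, E) ∞ M] [IsManifold 𝓘(ℝ, E) r M]
    {m : ℕ} (f : VField E M) (g : Fin m → VField E M)
    (hf : IsVFieldOn r Set.univ f) (hg : ∀ i, IsVFieldOn r Set.univ (g i))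
    (D : GenDistribution E M) (hD : IsInvolutiveRegularDistribution r D)
    (p : M) (hp : IsRegularPoint (quotientSubbundle (spanDistribution g) D) p) :
    LocallyControlledInvariantAt r f g D p ↔
      ∀ W ∈ 𝓝 p, ∃ U : Set M, IsOpen U ∧ p ∈ U ∧ U ⊆ W ∧
        (∀ i, bracketSet (g i) (sectionsOn r U D) ⊆
          sectionsOn r U D + sectionsOn r U (spanDistribution g)) ∧
        bracketSet f (sectionsOn r U D) ⊆
          sectionsOn r U D + sectionsOn r U (spanDistribution g) := by
  have : CompleteSpace E := FiniteDimensional.complete ℝ E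
  exact ⟨bracket_subset_of_locallyControlledInvariantAt hr hf hg,
    locallyControlledInvariantAt_of_bracket_subset hr hf hg hD hp⟩
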